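/- Let $\mathbb{K}$ be a field of characteristic zero and let $\Sigma$ be a signature, that is, a set with an arity map $\mathrm{ar} : \Sigma \to \mathbb{N}$. **The Hopf algebra $\mathbf{N}(T(\Sigma))$.** A $\Sigma$-term is either the leaf or $s(t_1, \dots, t_{\mathrm{ar}(s)})$ with $s \in \Sigma$ and $t_i$ $\Sigma$-terms. The terms form the free operad $T(\Sigma)$: for a term $y$ with $n$ leaves, $y[w_1, \dots, w_n]$ is obtained by grafting the term $w_i$ onto the $i$-th leaf of $y$, and the unit is the leaf. A reduced $\Sigma$-forest is a word of terms different from the leaf, and $\mathrm{rd}(w)$ is the word obtained from a word $w$ of terms by deleting the leaves. $\mathbf{N}(T(\Sigma))$ is the $\mathbb{K}$-vector space with basis $E_\mathfrak{f}$, $\mathfrak{f}$ a reduced $\Sigma$-forest, with product $E_\mathfrak{f} \cdot E_\mathfrak{g} = E_{\mathfrak{f}\mathfrak{g}}$ (concatenation), with counit sending $E_\mathfrak{f}$ to $1$ if $\mathfrak{f}$ is empty and to $0$ otherwise, and with the coproduct that is the algebra morphism such that, for any term $x$ different from the leaf, $$\Delta E_x = \sum_{x = y[w_1, \dots, w_n]}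 E_{\mathrm{rd}(y)} \otimes E_{\mathrm{rd}(w_1 \cdots w_n)} .$$ **The Hopf algebra $\mathbf{NCK}(\Sigma)$.** A $\Sigma$-trimmed forest is a word of nonempty planar rooted trees in which each node is decorated by some $s \in \Sigma$ and has at most $\mathrm{ar}(s)$ children. For a set $I$ of nodes of such a forest $f$, $f(I)$ is the trimmed forest obtained by keeping only the nodes of $I$ and the edges between them. $\mathbf{NCK}(\Sigma)$ is the $\mathbb{K}$-vector space with basis $E_f$, $f$ a $\Sigma$-trimmed forest, with the concatenation product, the counit sending $E_f$ to $1$ if $f$ is empty and to $0$ otherwise, and the coproduct $$\Delta E_f = \sum_{(I_1, I_2)} E_{f(I_1)} \otimes E_{f(I_2)},$$ over the pairs of disjoint sets $I_1, I_2$ whose union is the set of all nodes of $f$, such that $I_1$ contains all ancestors of its elements and $I_2$ contains all descendants of its elements. For a reduced $\Sigma$-forest $\mathfrak{f}$, let $\mathrm{tr}(\mathfrak{f})$ be the $\Sigma$-trimmed forest obtained by removing the leaves of $\mathfrak{f}$. **The map $\mathsf{r}_{A}$.** The alphabet of positions $A_{\mathrm{p}}(\Sigma)$ consists of the letters $\mathbf{a}^s_u$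 with $s \in \Sigma$ and $u$ a word on $\mathbb{N}$; the letters $\mathbf{a}^s_{0^\ell}$ are its root letters, the letters $\mathbf{a}^s_u$ are its $s$-decorated letters, and for $j \geq 1$ its $j$-edges are the pairs $(\mathbf{a}^s_u, \mathbf{a}^{s'}_{u j 0^\ell})$, for all $s, s', u, \ell$. The alphabet of lengths $A_{\mathrm{l}}(\Sigma)$ is the quotient of $A_{\mathrm{p}}(\Sigma)$ identifying $\mathbf{a}^s_u$ and $\mathbf{a}^s_v$ when $u$ and $v$ have the same length, with the image relations. For an alphabet $A$ with such relations, a word on $A$ is compatible with a reduced forest $\mathfrak{f}$ if its length is the number of internal nodes of $\mathfrak{f}$ and, when its letters are associated with the internal nodes in left to right preorder, the roots have root letters, each node decorated by $s$ has an $s$-decorated letter, and the letters of a node and of its $j$-th child form a $j$-edge. Let $\mathsf{r}_A$ be the linear map from $\mathbf{N}(T(\Sigma))$ to the space of noncommutative polynomials on $A$ (of finite degree, with possibly infinite support) sending $E_\mathfrak{f}$ to the sum of all words compatible with $\mathfrak{f}$. **Theorem.** The kernel of $\mathsf{r}_{A_{\mathrm{l}}(\Sigma)}$ is the subspace of $\mathbf{N}(T(\Sigma))$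 spanned by the differences $E_{\mathfrak{f}_1} - E_{\mathfrak{f}_2}$, where $\mathfrak{f}_1$ and $\mathfrak{f}_2$ are reduced $\Sigma$-forests with $\mathrm{tr}(\mathfrak{f}_1) = \mathrm{tr}(\mathfrak{f}_2)$. This kernel is a Hopf ideal, and there is a unique linear map $$\phi : \mathbf{N}(T(\Sigma)) / \operatorname{Ker} \mathsf{r}_{A_{\mathrm{l}}(\Sigma)} \to \mathbf{NCK}(\Sigma)$$ sending the class of $E_\mathfrak{f}$ to $E_{\mathrm{tr}(\mathfrak{f})}$ for each reduced $\Sigma$-forest $\mathfrak{f}$; this map $\phi$ is an isomorphism of Hopf algebras. -/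

import Mathlib

open scoped TensorProduct
namespace NaturalHopf

/-! ### Words with concatenation product -/

section WordAlgebra
variable (K : Type*) [Field K] (X : Type*)

/-- The `K`-linear span of the words on `X`, with the concatenation product. -/
def WordAlg : Type _ := MonoidAlgebra K (FreeMonoid X)

noncomputable instance : Ring (WordAlg K X) := inferInstanceAs (Ring (MonoidAlgebra K (FreeMonoid X)))
noncomputable instance : Algebra K (WordAlg K X) :=
  inferInstanceAs (Algebra K (MonoidAlgebra K (FreeMonoid X)))

variable {X}
/-- The basis element `E_f` indexed by the word `f`. -/
noncomputable def E (f : List X) : WordAlg K X :=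
  MonoidAlgebra.of K (FreeMonoid X) (FreeMonoid.ofList f)

variable (X) in
/-- The elementary basis. -/
noncomputable def eBasis : Module.Basis (List X) K (WordAlg K X) :=
  MonoidAlgebra.basis (FreeMonoid X) K

variable {K}

@[simp] theorem eBasis_apply (f : List X) : eBasis K X f = E K f := by
  simp only [eBasis]
  exact MonoidAlgebra.basis_apply K (FreeMonoid.ofList f)

theorem E_nil : E K ([] : List X) = 1 := map_one (MonoidAlgebra.of K (FreeMonoid X))

theorem E_append (f g : List X) : E K (f ++ g) = E K f * E K g :=
  map_mul (MonoidAlgebra.of K (FreeMonoid X)) _ _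

/-- The unital algebra morphism with prescribed values on the letters. -/
noncomputable def liftWord {B : Type*} [Ring B] [Algebra K B] (g : X → B) : WordAlg K X →ₐ[K] B :=
  MonoidAlgebra.lift K B (FreeMonoid X) (FreeMonoid.lift g)

theorem liftWord_E {B : Type*} [Ring B] [Algebra K B] (g : X → B) (f : List X) :
    liftWord g (E K f) = (f.map g).prod := by
  have : liftWord (K := K) g (E K f) = FreeMonoid.lift g (FreeMonoid.ofList f) :=
    MonoidAlgebra.lift_of _ _
  rw [this, FreeMonoid.lift_apply]; rfl

theorem word_induction {p : WordAlg K X → Prop} (hE : ∀ f, p (E K f))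
    (hadd : ∀ x y, p x → p y → p (x + y)) (hsmul : ∀ (a : K) x, p x → p (a • x))
    (x : WordAlg K X) : p x := by
  have hx : x ∈ Submodule.span K (Set.range (eBasis K X)) := by
    rw [Module.Basis.span_eq]; trivial
  refine Submodule.span_induction ?_ ?_ (fun x y _ _ => hadd x y) (fun a x _ => hsmul a x) hx
  · rintro _ ⟨f, rfl⟩
    rw [eBasis_apply]
    exact hE f
  · have := hsmul 0 _ (hE [])
    rwa [zero_smul] at this

theorem algHom_ext_word {B : Type*} [Ring B] [Algebra K B] {g h : WordAlg K X →ₐ[K] B}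
    (H : ∀ x, g (E K [x]) = h (E K [x])) : g = h := by
  apply AlgHom.toLinearMap_injective
  apply (eBasis K X).ext
  intro f
  simp only [eBasis_apply, AlgHom.toLinearMap_apply]
  induction f with
  | nil => simp [E_nil]
  | cons x f ih =>
    have : x :: f = [x] ++ f := rfl
    rw [this, E_append, map_mul, map_mul, H, ih]

end WordAlgebra

/-! ### Bialgebras and Hopf algebras from cuts (auxiliary) -/

section Cuts
variable {X : Type*}

/-- Extension of a family of cuts from letters to words. -/
def cutWord (c : X → Multiset (List X × List X)) : List X → Multiset (List X × List X)
  | [] => {([], [])}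
  | x :: f => (c x).bind fun p => (cutWord c f).map fun q => (p.1 ++ q.1, p.2 ++ q.2)

theorem cutWord_append (c : X → Multiset (List X × List X)) (f g : List X) :
    cutWord c (f ++ g) =
      (cutWord c f).bind fun p => (cutWord c g).map fun q => (p.1 ++ q.1, p.2 ++ q.2) := by
  induction f with
  | nil => simp [cutWord]
  | cons x f ih =>
    simp only [List.cons_append, cutWord, ih, Multiset.bind_assoc, Multiset.map_bind,
      Multiset.bind_map, Multiset.map_map, Function.comp_def, List.append_assoc]

theorem cutWord_singleton (c : X → Multiset (List X × List X)) (x : X) :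
    cutWord c [x] = c x := by
  simp only [cutWord, Multiset.map_singleton, List.append_nil]
  exact (Multiset.bind_singleton _ _).trans (Multiset.map_id _)

theorem sum_map_bind {α β M : Type*} [AddCommMonoid M] (m : Multiset α) (f : α → Multiset β)
    (g : β → M) : ((m.bind f).map g).sum = (m.map fun a => ((f a).map g).sum).sum := by
  rw [Multiset.map_bind, Multiset.sum_bind]

variable {K : Type*} [Field K]

/-- The sum of `E_u ⊗ E_l` over a multiset of pairs `(u, l)`. -/
noncomputable def sumE (m : Multiset (List X × List X)) : WordAlg K X ⊗[K] WordAlg K X :=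
  (m.map fun p => E K p.1 ⊗ₜ[K] E K p.2).sum

theorem sumE_mul (m n : Multiset (List X × List X)) :
    sumE (K := K) (m.bind fun p => n.map fun q => (p.1 ++ q.1, p.2 ++ q.2)) =
      sumE m * sumE n := by
  unfold sumE
  rw [sum_map_bind, ← Multiset.sum_map_mul_right]
  congr 1
  refine Multiset.map_congr rfl fun p _ => ?_
  rw [← Multiset.sum_map_mul_left, Multiset.map_map]
  congr 1
  refine Multiset.map_congr rfl fun q _ => ?_
  simp [E_append, Algebra.TensorProduct.tmul_mul_tmul]

theorem sumE_nil : sumE (K := K) {(([] : List X), ([] : List X))} = 1 := by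
  simp [sumE, E_nil, Algebra.TensorProduct.one_def]

/-- The counit: `1` on the empty word, `0` on the other words. -/
noncomputable def counitWord (K : Type*) [Field K] (X : Type*) : WordAlg K X →ₐ[K] K :=
  liftWord fun _ => 0

theorem counitWord_E (f : List X) :
    counitWord K X (E K f) = if f = [] then 1 else 0 := by
  rw [counitWord, liftWord_E]
  cases f <;> simp

theorem map_multiset_sum' {F A B ι : Type*} [AddCommMonoid A] [AddCommMonoid B] [FunLike F A B]
    [AddMonoidHomClass F A B] (g : F) (m : Multiset ι) (h : ι → A) :
    g (m.map h).sum = (m.map fun i => g (h i)).sum := by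
  rw [map_multiset_sum, Multiset.map_map]; rfl

/-- The bialgebra of a coassociative counital family of cuts. -/
@[reducible] noncomputable def bialgebraOfCuts (c : X → Multiset (List X × List X))
    (Δ : WordAlg K X →ₐ[K] WordAlg K X ⊗[K] WordAlg K X)
    (hΔ : ∀ f, Δ (E K f) = sumE (cutWord c f))
    (hassoc : ∀ x, ((c x).bind fun p => (cutWord c p.1).map fun q => (q.1, q.2, p.2)) =
      (c x).bind fun p => (cutWord c p.2).map fun q => (p.1, q.1, q.2))
    (hl : ∀ x, ((c x).bind fun p => if p.1 = [] then {p.2} else 0) = {[x]})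
    (hr : ∀ x, ((c x).bind fun p => if p.2 = [] then {p.1} else 0) = {[x]}) :
    Bialgebra K (WordAlg K X) :=
  Bialgebra.ofAlgHom Δ (counitWord K X)
    (by
      apply algHom_ext_word
      intro x
      have H := congrArg (fun m => (m.map fun p : List X × List X × List X =>
        E K p.1 ⊗ₜ[K] (E K p.2.1 ⊗ₜ[K] E K p.2.2)).sum) (hassoc x)
      simp only [sum_map_bind, Multiset.map_map, Function.comp_def] at H
      simp only [AlgHom.comp_apply, hΔ, cutWord_singleton]
      simp only [sumE, map_multiset_sum', Algebra.TensorProduct.map_tmul, hΔ, AlgHom.id_apply]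
      refine Eq.trans ?_ (H.trans ?_)
      · congr 1
        refine Multiset.map_congr rfl fun p _ => ?_
        have : ∀ z : WordAlg K X ⊗[K] WordAlg K X, ∀ y : WordAlg K X,
          z ⊗ₜ[K] y = (TensorProduct.mk K _ _).flip y z := fun _ _ => rfl
        rw [this, map_multiset_sum']
        erw [map_multiset_sum']
        rfl
      · congr 1
        refine Multiset.map_congr rfl fun p _ => ?_
        have : ∀ z : WordAlg K X ⊗[K] WordAlg K X, ∀ y : WordAlg K X,
          y ⊗ₜ[K] z = (TensorProduct.mk K _ _) y z := fun _ _ => rfl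
        rw [this, map_multiset_sum']
        rfl)
    (by
      apply algHom_ext_word
      intro x
      have H := congrArg (fun m => (m.map fun p : List X =>
        (1 : K) ⊗ₜ[K] E K p).sum) (hl x)
      simp only [sum_map_bind, Multiset.map_singleton, Multiset.sum_singleton] at H
      simp only [AlgHom.comp_apply, hΔ, cutWord_singleton]
      simp only [sumE, map_multiset_sum', Algebra.TensorProduct.map_tmul, counitWord_E,
        AlgHom.id_apply]
      refine Eq.trans ?_ (H.trans ?_)
      · congr 1
        refine Multiset.map_congr rfl fun p _ => ?_
        by_cases h : p.1 = [] <;> simp [h]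
      · simp)
    (by
      apply algHom_ext_word
      intro x
      have H := congrArg (fun m => (m.map fun p : List X =>
        E K p ⊗ₜ[K] (1 : K)).sum) (hr x)
      simp only [sum_map_bind, Multiset.map_singleton, Multiset.sum_singleton] at H
      simp only [AlgHom.comp_apply, hΔ, cutWord_singleton]
      simp only [sumE, map_multiset_sum', Algebra.TensorProduct.map_tmul, counitWord_E,
        AlgHom.id_apply]
      refine Eq.trans ?_ (H.trans ?_)
      · congr 1
        refine Multiset.map_congr rfl fun p _ => ?_
        by_cases h : p.2 = [] <;> simp [h]
      · simp)

end Cuts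

section Antipode
variable {K A ι : Type*} [Field K] [Ring A] [Bialgebra K A]
open WithConv Coalgebra

theorem conv_apply_of_comul {a : A} {m : Multiset (ι × ι)} {b : ι → A}
    (h : comul (R := K) a = (m.map fun p => b p.1 ⊗ₜ[K] b p.2).sum)
    (f g : WithConv (A →ₗ[K] A)) :
    (f * g) a = (m.map fun p => f (b p.1) * g (b p.2)).sum := by
  rw [LinearMap.convMul_apply, h, map_multiset_sum', map_multiset_sum']
  rfl

/-- A bialgebra with a basis graded by natural numbers, whose coproduct respects the degree and
whose elements of degree zero are scalars, is a Hopf algebra. -/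
@[reducible] noncomputable def hopfOfGraded (b : Module.Basis ι K A) (d : ι → ℕ)
    (h0 : ∀ i, d i = 0 → b i = algebraMap K A (counit (b i)))
    (hΔ : ∀ i, ∃ m : Multiset (ι × ι),
      comul (R := K) (b i) = (m.map fun p => b p.1 ⊗ₜ[K] b p.2).sum ∧
        ∀ p ∈ m, d p.1 + d p.2 ≤ d i) : HopfAlgebra K A :=
  let x : WithConv (A →ₗ[K] A) := 1 - toConv LinearMap.id
  let T : ℕ → WithConv (A →ₗ[K] A) := fun n => ∑ k ∈ Finset.range n, x ^ k
  let S : A →ₗ[K] A := b.constr K fun i => T (d i + 1) (b i)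
  have hx0 : ∀ i, d i = 0 → x (b i) = 0 := fun i hi => by
    change algebraMap K A (counit (b i)) - b i = 0
    rw [← h0 i hi, sub_self]
  have hxn : ∀ n i, d i < n → (x ^ n) (b i) = 0 := by
    intro n
    induction n with
    | zero => intro i hi; omega
    | succ n ih =>
      intro i hi
      obtain ⟨m, hm, hd⟩ := hΔ i
      rw [pow_succ', conv_apply_of_comul hm]
      apply Multiset.sum_eq_zero
      intro y hy
      obtain ⟨p, hp, rfl⟩ := Multiset.mem_map.1 hy
      have := hd p hp
      by_cases h : d p.1 = 0
      · rw [hx0 _ h, zero_mul]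
      · rw [ih p.2 (by omega), mul_zero]
  have hT : ∀ n i, d i < n → T n (b i) = S (b i) := by
    intro n i hi
    have hS : S (b i) = T (d i + 1) (b i) := by simp [S]
    rw [hS]
    induction n, hi using Nat.le_induction with
    | base => rfl
    | succ n hn ih =>
      rw [← ih]
      change (∑ k ∈ Finset.range (n + 1), x ^ k) (b i) = _
      rw [Finset.sum_range_succ]
      change (T n) (b i) + (x ^ n) (b i) = _
      rw [hxn n i hn, add_zero]
  have hid : toConv LinearMap.id = 1 - x := by simp [x]
  HopfAlgebra.ofConvInverse S
    (by
      apply ofConv_injective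
      apply b.ext
      intro i
      obtain ⟨m, hm, hd⟩ := hΔ i
      change (toConv S * toConv LinearMap.id : WithConv (A →ₗ[K] A)) (b i) = (1 : WithConv (A →ₗ[K] A)) (b i)
      have h1 : (T (d i + 1) * toConv LinearMap.id : WithConv (A →ₗ[K] A)) (b i) = (1 : WithConv (A →ₗ[K] A)) (b i) := by
        rw [hid, geom_sum_mul_neg]
        change (1 : WithConv (A →ₗ[K] A)) (b i) - (x ^ (d i + 1)) (b i) = _
        rw [hxn _ _ (Nat.lt_succ_self _), sub_zero]
      rw [← h1, conv_apply_of_comul hm, conv_apply_of_comul hm]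
      congr 1
      refine Multiset.map_congr rfl fun p hp => ?_
      have := hd p hp
      rw [hT (d i + 1) p.1 (by omega)])
    (by
      apply ofConv_injective
      apply b.ext
      intro i
      obtain ⟨m, hm, hd⟩ := hΔ i
      change (toConv LinearMap.id * toConv S : WithConv (A →ₗ[K] A)) (b i) = (1 : WithConv (A →ₗ[K] A)) (b i)
      have h1 : (toConv LinearMap.id * T (d i + 1) : WithConv (A →ₗ[K] A)) (b i) = (1 : WithConv (A →ₗ[K] A)) (b i) := by
        rw [hid, mul_neg_geom_sum]
        change (1 : WithConv (A →ₗ[K] A)) (b i) - (x ^ (d i + 1)) (b i) = _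
        rw [hxn _ _ (Nat.lt_succ_self _), sub_zero]
      rw [← h1, conv_apply_of_comul hm, conv_apply_of_comul hm]
      congr 1
      refine Multiset.map_congr rfl fun p hp => ?_
      have := hd p hp
      rw [hT (d i + 1) p.2 (by omega)])

end Antipode

section CutSystem

/-- Simultaneous choice of cuts for a finite sequence: the upper parts form a sequence and
the lower parts are concatenated. -/
def cutSeq {T X : Type*} : (n : ℕ) → (Fin n → Multiset (T × List X)) →
    Multiset ((Fin n → T) × List X)
  | 0, _ => {(Fin.elim0, [])}
  | n + 1, m => (m 0).bind fun p =>
      (cutSeq n fun i => m i.succ).map fun q => (Fin.cons p.1 q.1, p.2 ++ q.2)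

/-- Auxiliary: trees over `X` (with an empty tree) together with their cuts, described by
the recursion over the children of the root. -/
structure CutSystem (T X : Type*) where
  leaf : T
  inc : X → T
  toWord : T → List X
  cuts : T → Multiset (T × List X)
  deg : T → ℕ
  toWord_leaf : toWord leaf = []
  toWord_inc : ∀ x, toWord (inc x) = [x]
  cuts_leaf : cuts leaf = {(leaf, [])}
  deg_leaf : deg leaf = 0
  ind : ∀ P : T → Prop, P leaf →
    (∀ (n : ℕ) (mk : (Fin n → T) → X),
      (∀ us, cuts (inc (mk us)) = (leaf, [mk us]) ::ₘ
        (cutSeq n fun i => cuts (us i)).map fun p => (inc (mk p.1), p.2)) →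
      (∀ us, deg (inc (mk us)) = 1 + ∑ i, deg (us i)) →
      ∀ ts, (∀ i, P (ts i)) → P (inc (mk ts))) → ∀ t, P t

namespace CutSystem
variable {T X : Type*} (C : CutSystem T X)

/-- The cuts of a letter, as pairs of words. -/
def letterCuts (x : X) : Multiset (List X × List X) :=
  (C.cuts (C.inc x)).map fun p => (C.toWord p.1, p.2)

theorem eq_leaf_or_inc (t : T) : t = C.leaf ∨ ∃ x, t = C.inc x :=
  C.ind (fun t => t = C.leaf ∨ ∃ x, t = C.inc x) (Or.inl rfl)
    (fun _ _ _ _ _ _ => Or.inr ⟨_, rfl⟩) t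

theorem cutWord_toWord (t : T) : cutWord C.letterCuts (C.toWord t) =
    (C.cuts t).map fun p => (C.toWord p.1, p.2) := by
  rcases C.eq_leaf_or_inc t with rfl | ⟨x, rfl⟩
  · simp [C.toWord_leaf, C.cuts_leaf, cutWord]
  · rw [C.toWord_inc, cutWord_singleton]; rfl

theorem seq_coassoc {n : ℕ} (ts : Fin n → T)
    (h : ∀ i, ((C.cuts (ts i)).bind fun p => (C.cuts p.1).map fun q => (q.1, q.2, p.2)) =
      (C.cuts (ts i)).bind fun p => (cutWord C.letterCuts p.2).map fun q => (p.1, q.1, q.2)) :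
    ((cutSeq n fun i => C.cuts (ts i)).bind fun p =>
        (cutSeq n fun i => C.cuts (p.1 i)).map fun q => (q.1, q.2, p.2)) =
      (cutSeq n fun i => C.cuts (ts i)).bind fun p =>
        (cutWord C.letterCuts p.2).map fun q => (p.1, q.1, q.2) := by
  induction n with
  | zero => simp [cutSeq, cutWord]
  | succ n ih =>
    have ih' := ih (fun i => ts i.succ) (fun i => h i.succ)
    have h0 := h 0
    simp only [cutSeq, Multiset.bind_assoc, Multiset.bind_map, Multiset.map_bind,
      Multiset.map_map, Function.comp_def, Fin.cons_zero, Fin.cons_succ, cutWord_append]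
    have e1 := congrArg (fun m => m.bind fun r : T × List X × List X =>
      ((cutSeq n fun i => C.cuts (ts i.succ)).bind fun p =>
        (cutSeq n fun i => C.cuts (p.1 i)).map fun q =>
          ((Fin.cons r.1 q.1 : Fin (n + 1) → T), r.2.1 ++ q.2, r.2.2 ++ p.2))) h0
    simp only [Multiset.bind_assoc, Multiset.bind_map] at e1
    have e2 : ∀ r : T × List X × List X,
      ((cutSeq n fun i => C.cuts (ts i.succ)).bind fun p =>
        (cutSeq n fun i => C.cuts (p.1 i)).map fun q =>
          ((Fin.cons r.1 q.1 : Fin (n + 1) → T), r.2.1 ++ q.2, r.2.2 ++ p.2)) =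
      ((cutSeq n fun i => C.cuts (ts i.succ)).bind fun p =>
        (cutWord C.letterCuts p.2).map fun q =>
          ((Fin.cons r.1 p.1 : Fin (n + 1) → T), r.2.1 ++ q.1, r.2.2 ++ q.2)) := fun r => by
      have := congrArg (fun m => m.map fun s : (Fin n → T) × List X × List X =>
        ((Fin.cons r.1 s.1 : Fin (n + 1) → T), r.2.1 ++ s.2.1, r.2.2 ++ s.2.2)) ih'
      simpa only [Multiset.map_bind, Multiset.map_map, Function.comp_def] using this
    refine (Multiset.bind_congr fun p _ => Multiset.bind_bind _ _).trans (e1.trans ?_)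
    refine Multiset.bind_congr fun p _ => ?_
    refine (Multiset.bind_congr fun q _ => e2 (p.1, q.1, q.2)).trans ?_
    exact Multiset.bind_bind _ _

theorem coassoc_tree (t : T) :
    ((C.cuts t).bind fun p => (C.cuts p.1).map fun q => (q.1, q.2, p.2)) =
      (C.cuts t).bind fun p => (cutWord C.letterCuts p.2).map fun q => (p.1, q.1, q.2) := by
  revert t
  refine C.ind _ ?_ ?_
  · simp [C.cuts_leaf, cutWord]
  · intro n mk hmk _ ts ih
    have e := congrArg (fun m => m.map fun r : (Fin n → T) × List X × List X =>
      (C.inc (mk r.1), r.2.1, r.2.2)) (C.seq_coassoc ts ih)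
    simp only [Multiset.map_bind, Multiset.map_map, Function.comp_def] at e
    have e0 : (cutWord C.letterCuts [mk ts]).map (fun q => (C.leaf, q.1, q.2)) =
      (C.cuts (C.inc (mk ts))).map fun p => (C.leaf, C.toWord p.1, p.2) := by
      rw [cutWord_singleton]; simp [letterCuts, Multiset.map_map]
    rw [hmk ts]
    simp only [Multiset.cons_bind, Multiset.bind_map, C.cuts_leaf, Multiset.map_singleton]
    rw [e0, hmk ts, ← e]
    simp only [hmk, Multiset.map_cons, Multiset.map_map, Function.comp_def, C.toWord_leaf,
      C.toWord_inc]
    rw [Multiset.bind_cons, Multiset.cons_add, Multiset.singleton_add]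

theorem coassoc_letter (x : X) :
    ((C.letterCuts x).bind fun p => (cutWord C.letterCuts p.1).map fun q => (q.1, q.2, p.2)) =
      (C.letterCuts x).bind fun p => (cutWord C.letterCuts p.2).map fun q => (p.1, q.1, q.2) := by
  have := congrArg (fun m => m.map fun r : T × List X × List X =>
    (C.toWord r.1, r.2.1, r.2.2)) (C.coassoc_tree (C.inc x))
  simp only [Multiset.map_bind, Multiset.map_map, Function.comp_def] at this
  simp only [letterCuts, Multiset.bind_map]
  refine Eq.trans ?_ this
  refine Multiset.bind_congr fun p _ => ?_
  erw [C.cutWord_toWord]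
  simp only [Multiset.map_map, Function.comp_def]

theorem counit_left (x : X) :
    ((C.letterCuts x).bind fun p => if p.1 = [] then {p.2} else 0) = {[x]} := by
  have key : ∀ t, (∀ x, t = C.inc x →
      ((C.letterCuts x).bind fun p => if p.1 = [] then {p.2} else 0) = {[x]}) := by
    refine C.ind _ ?_ ?_
    · intro x hx
      have := C.toWord_inc x
      rw [← hx, C.toWord_leaf] at this
      simp at this
    · intro n mk hmk _ ts _ x hx
      have := C.toWord_inc x
      rw [← hx, C.toWord_inc] at this
      obtain rfl : mk ts = x := by simpa using this
      simp [letterCuts, hmk, Multiset.bind_map, C.toWord_leaf, C.toWord_inc]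
  exact key _ x rfl

theorem seq_counit_right {n : ℕ} (ts : Fin n → T)
    (h : ∀ i, ((C.cuts (ts i)).bind fun p => if p.2 = [] then {p.1} else 0) = {ts i}) :
    ((cutSeq n fun i => C.cuts (ts i)).bind fun p => if p.2 = [] then {p.1} else 0) = {ts} := by
  induction n with
  | zero => simp [cutSeq]; exact funext fun i => i.elim0
  | succ n ih =>
    have ih' := ih (fun i => ts i.succ) (fun i => h i.succ)
    simp only [cutSeq, Multiset.bind_assoc, Multiset.bind_map]
    have e : ∀ p : T × List X, ((cutSeq n fun i => C.cuts (ts i.succ)).bind fun a =>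
        if p.2 ++ a.2 = [] then ({Fin.cons p.1 a.1} : Multiset (Fin (n + 1) → T)) else 0) =
        (if p.2 = [] then {p.1} else 0 : Multiset T).bind fun u =>
          {(Fin.cons u fun i => ts i.succ : Fin (n + 1) → T)} := by
      intro p
      by_cases hp : p.2 = []
      · simp only [hp, List.nil_append, if_true, Multiset.singleton_bind]
        have := congrArg (fun m => m.map fun s : Fin n → T =>
          (Fin.cons p.1 s : Fin (n + 1) → T)) ih'
        simp only [Multiset.map_bind, Multiset.map_singleton] at this
        rw [← this]
        refine Multiset.bind_congr fun a _ => ?_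
        split_ifs <;> simp
      · simp [hp]
    simp only [e]
    rw [← Multiset.bind_assoc, h 0, Multiset.singleton_bind]
    congr 1
    exact Fin.cons_self_tail ts

theorem counit_right_tree (t : T) :
    ((C.cuts t).bind fun p => if p.2 = [] then {p.1} else 0) = {t} := by
  revert t
  refine C.ind _ ?_ ?_
  · simp [C.cuts_leaf]
  · intro n mk hmk _ ts ih
    have := congrArg (fun m => m.map fun s : Fin n → T => C.inc (mk s)) (C.seq_counit_right ts ih)
    simp only [Multiset.map_bind, Multiset.map_singleton] at this
    rw [hmk]
    simp only [Multiset.cons_bind, Multiset.bind_map, List.cons_ne_nil, if_false, zero_add]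
    rw [← this]
    refine Multiset.bind_congr fun a _ => ?_
    split_ifs <;> simp

theorem counit_right (x : X) :
    ((C.letterCuts x).bind fun p => if p.2 = [] then {p.1} else 0) = {[x]} := by
  have := congrArg (fun m => m.map C.toWord) (C.counit_right_tree (C.inc x))
  simp only [Multiset.map_bind, Multiset.map_singleton, C.toWord_inc] at this
  rw [← this, letterCuts, Multiset.bind_map]
  refine Multiset.bind_congr fun a _ => ?_
  simp only
  split_ifs <;> simp

/-- The degree of a word. -/
def wordDeg (f : List X) : ℕ := (f.map fun x => C.deg (C.inc x)).sum

theorem seq_deg {n : ℕ} (ts : Fin n → T)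
    (h : ∀ i, ∀ p ∈ C.cuts (ts i), C.deg p.1 + C.wordDeg p.2 = C.deg (ts i)) :
    ∀ p ∈ cutSeq n fun i => C.cuts (ts i),
      (∑ i, C.deg (p.1 i)) + C.wordDeg p.2 = ∑ i, C.deg (ts i) := by
  induction n with
  | zero => simp [cutSeq, wordDeg]
  | succ n ih =>
    have ih' := ih (fun i => ts i.succ) (fun i => h i.succ)
    intro p hp
    simp only [cutSeq, Multiset.mem_bind, Multiset.mem_map] at hp
    obtain ⟨a, ha, q, hq, rfl⟩ := hp
    have h1 := h 0 a ha
    have h2 := ih' q hq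
    simp only [Fin.sum_univ_succ, Fin.cons_zero, Fin.cons_succ, wordDeg, List.map_append,
      List.sum_append] at *
    omega

theorem deg_tree (t : T) : ∀ p ∈ C.cuts t, C.deg p.1 + C.wordDeg p.2 = C.deg t := by
  revert t
  refine C.ind _ ?_ ?_
  · simp [C.cuts_leaf, wordDeg]
  · intro n mk hmk hdeg ts ih p hp
    rw [hmk, Multiset.mem_cons, Multiset.mem_map] at hp
    rcases hp with rfl | ⟨q, hq, rfl⟩
    · simp [wordDeg, C.deg_leaf]
    · have := C.seq_deg ts ih q hq
      simp only [hdeg]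
      omega

theorem wordDeg_toWord (t : T) : C.wordDeg (C.toWord t) = C.deg t := by
  rcases C.eq_leaf_or_inc t with rfl | ⟨x, rfl⟩
  · simp [C.toWord_leaf, C.deg_leaf, wordDeg]
  · simp [C.toWord_inc, wordDeg]

theorem deg_word (f : List X) :
    ∀ p ∈ cutWord C.letterCuts f, C.wordDeg p.1 + C.wordDeg p.2 = C.wordDeg f := by
  induction f with
  | nil => simp [cutWord, wordDeg]
  | cons x f ih =>
    intro p hp
    simp only [cutWord, Multiset.mem_bind, Multiset.mem_map, letterCuts] at hp
    obtain ⟨a, ⟨b, hb, rfl⟩, q, hq, rfl⟩ := hp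
    have h1 := C.deg_tree _ b hb
    have h2 := ih q hq
    have h3 := C.wordDeg_toWord b.1
    simp only [wordDeg, List.map_append, List.sum_append, List.map_cons, List.sum_cons] at *
    omega

theorem deg_inc_pos (x : X) : 0 < C.deg (C.inc x) := by
  have key : ∀ t, t = C.leaf ∨ 0 < C.deg t := fun t =>
    C.ind (fun t => t = C.leaf ∨ 0 < C.deg t) (Or.inl rfl)
      (fun _ _ _ hd _ _ => Or.inr (by rw [hd]; omega)) t
  rcases key (C.inc x) with h | h
  · have := C.toWord_inc x
    rw [h, C.toWord_leaf] at this
    simp at this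
  · exact h

variable {K : Type*} [Field K]

/-- The Hopf algebra of a system of cuts. -/
@[reducible] noncomputable def hopf (Δ : WordAlg K X →ₐ[K] WordAlg K X ⊗[K] WordAlg K X)
    (hΔ : ∀ f, Δ (E K f) = sumE (cutWord C.letterCuts f)) : HopfAlgebra K (WordAlg K X) :=
  letI := bialgebraOfCuts C.letterCuts Δ hΔ C.coassoc_letter C.counit_left C.counit_right
  hopfOfGraded (eBasis K X) C.wordDeg
    (by
      intro f hf
      have : f = [] := by
        cases f with
        | nil => rfl
        | cons x f =>
          have := C.deg_inc_pos x
          simp [wordDeg] at hf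
          omega
      subst this
      rw [eBasis_apply, E_nil, Bialgebra.counit_one, map_one])
    (by
      intro f
      refine ⟨cutWord C.letterCuts f, ?_, fun p hp => (C.deg_word f p hp).le⟩
      simp only [eBasis_apply]
      exact hΔ f)

end CutSystem
end CutSystem

/-! ### Terms, the free operad and its natural Hopf algebra -/

section Terms
variable {S : Type*} (ar : S → ℕ)

/-- Terms on the signature `S` with arity map `ar`: a leaf, or a symbol `s` applied to a
sequence of `ar s` terms. -/
inductive STerm : Type _
  | leaf : STerm
  | node (s : S) (ts : Fin (ar s) → STerm) : STerm

variable {ar}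

namespace STerm

/-- The number of internal nodes. -/
def deg : STerm ar → ℕ
  | leaf => 0
  | node _ ts => 1 + ∑ i, (ts i).deg

/-- The number of leaves. -/
def arity : STerm ar → ℕ
  | leaf => 1
  | node _ ts => ∑ i, (ts i).arity

/-- The full composition `t[w_1, …, w_n]` of the free operad: the term `w_i` is grafted onto the
`i`-th leaf of `t`, the leaves being numbered from left to right. -/
def graft : (t : STerm ar) → (Fin t.arity → STerm ar) → STerm ar
  | leaf, w => w (0 : Fin 1)
  | node s ts, w => node s fun i => (ts i).graft fun j => w (finSigmaFinEquiv ⟨i, j⟩)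

end STerm

variable (ar) in
/-- Terms different from the leaf (the unit of the free operad). Reduced forests are the words
on this alphabet, that is, the elements of `List (NTerm ar)`. -/
abbrev NTerm := {t : STerm ar // t ≠ STerm.leaf}

open Classical in
/-- The reduced forest obtained from a forest by deleting the leaves among its terms. -/
noncomputable def rd (f : List (STerm ar)) : List (NTerm ar) :=
  f.filterMap fun t => if h : t = STerm.leaf then none else some ⟨t, h⟩

theorem rd_append (f g : List (STerm ar)) : rd (f ++ g) = rd f ++ rd g :=
  List.filterMap_append

theorem rd_flatten (f : List (List (STerm ar))) : rd f.flatten = (f.map rd).flatten := by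
  induction f with
  | nil => rfl
  | cons a f ih => rw [List.flatten_cons, rd_append, ih]; rfl

theorem rd_leaf : rd [(STerm.leaf : STerm ar)] = [] := by simp [rd]

theorem rd_node (s : S) (ts : Fin (ar s) → STerm ar) :
    rd [STerm.node s ts] = [⟨STerm.node s ts, by simp⟩] := by simp [rd]

theorem rd_val (x : NTerm ar) : rd [x.1] = [x] := by simp [rd, x.2]

variable (ar) in
/-- The underlying algebra of the natural Hopf algebra of the free operad: the span of the reduced
forests, with the concatenation product. -/
abbrev NatFree (K : Type*) [Field K] : Type _ := WordAlg K (NTerm ar)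

/-- The factorizations `x = y[w_1, …, w_n]` in the free operad. -/
def Factorization (x : STerm ar) : Type _ :=
  {p : Σ y : STerm ar, (Fin y.arity → STerm ar) // p.1.graft p.2 = x}

variable (K : Type*) [Field K]

/-- The coproduct on a generator:
`Δ E_x = ∑_{x = y[w_1, …, w_n]} E_{rd y} ⊗ E_{rd (w_1 … w_n)}` (a finite sum). -/
noncomputable def coprodTerm (x : STerm ar) : NatFree ar K ⊗[K] NatFree ar K :=
  ∑ᶠ p : Factorization x, E K (rd [p.1.1]) ⊗ₜ[K] E K (rd (List.ofFn p.1.2))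

variable (ar) in
/-- The coproduct: the algebra morphism extending `coprodTerm`. -/
noncomputable def natCoprod : NatFree ar K →ₐ[K] NatFree ar K ⊗[K] NatFree ar K :=
  liftWord fun x => coprodTerm K x.1

/-! Auxiliary: recursive description of the factorizations. -/

/-- The factorizations of a term with root are the trivial one and the ones obtained from
factorizations of the children of the root. -/
def Factorization.build (s : S) (ts : Fin (ar s) → STerm ar) :
    Option (∀ i, Factorization (ts i)) → Factorization (STerm.node s ts)
  | none => ⟨⟨STerm.leaf, fun _ => STerm.node s ts⟩, rfl⟩
  | some c => ⟨⟨STerm.node s fun i => (c i).1.1, fun k =>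
      (c (finSigmaFinEquiv.symm k).1).1.2 (finSigmaFinEquiv.symm k).2⟩, by
        simp only [STerm.graft]
        congr 1
        funext i
        refine Eq.trans ?_ (c i).2
        congr 1
        funext j
        rw [Equiv.symm_apply_apply]⟩

theorem Factorization.build_bijective (s : S) (ts : Fin (ar s) → STerm ar) :
    Function.Bijective (Factorization.build s ts) := by
  constructor
  · intro c d h
    cases c with
    | none =>
      cases d with
      | none => rfl
      | some d =>
        have := congrArg (fun p => p.1.1) h
        simp [build] at this
    | some c =>
      cases d with
      | none =>
        have := congrArg (fun p => p.1.1) h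
        simp [build] at this
      | some d =>
        obtain ⟨y, w, hw, rfl⟩ : ∃ (y : Fin (ar s) → STerm ar) (w : ∀ i, Fin (y i).arity → STerm ar)
            (hw : ∀ i, (y i).graft (w i) = ts i), c = fun i => ⟨⟨y i, w i⟩, hw i⟩ :=
          ⟨fun i => (c i).1.1, fun i => (c i).1.2, fun i => (c i).2, rfl⟩
        obtain ⟨z, v, hv, rfl⟩ : ∃ (y : Fin (ar s) → STerm ar) (w : ∀ i, Fin (y i).arity → STerm ar)
            (hw : ∀ i, (y i).graft (w i) = ts i), d = fun i => ⟨⟨y i, w i⟩, hw i⟩ :=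
          ⟨fun i => (d i).1.1, fun i => (d i).1.2, fun i => (d i).2, rfl⟩
        have h' := congrArg Subtype.val h
        simp only [build, Sigma.mk.injEq, STerm.node.injEq, heq_eq_eq, true_and] at h'
        obtain ⟨h1, h2⟩ := h'
        obtain rfl : y = z := h1
        have h3 := eq_of_heq h2
        congr 1
        funext i
        congr 2
        funext j
        have hh : ∀ p : (Σ i, Fin (y i).arity), p = ⟨i, j⟩ →
            w p.1 p.2 = v p.1 p.2 → w i j = v i j := by
          rintro _ rfl h
          exact h
        exact hh _ (Equiv.symm_apply_apply _ _) (congrFun h3 (finSigmaFinEquiv ⟨i, j⟩))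
  · rintro ⟨⟨y, w⟩, h⟩
    cases y with
    | leaf =>
      refine ⟨none, Subtype.ext ?_⟩
      simp only [build]
      congr 1
      funext i
      rw [show i = (0 : Fin 1) from Subsingleton.elim (α := Fin 1) i 0]
      exact h.symm
    | node s' ys =>
      simp only [STerm.graft, STerm.node.injEq] at h
      obtain ⟨rfl, h⟩ := h
      obtain rfl := eq_of_heq h
      refine ⟨some fun i => ⟨⟨ys i, fun j => w (finSigmaFinEquiv ⟨i, j⟩)⟩, rfl⟩, Subtype.ext ?_⟩
      simp only [build]
      congr 1
      funext k
      exact congrArg w (Equiv.apply_symm_apply finSigmaFinEquiv k)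

/-- Recursive description of factorizations, as an equivalence. -/
noncomputable def Factorization.equiv (s : S) (ts : Fin (ar s) → STerm ar) :
    Option (∀ i, Factorization (ts i)) ≃ Factorization (STerm.node s ts) :=
  Equiv.ofBijective _ (Factorization.build_bijective s ts)

instance Factorization.uniqueLeaf : Unique (Factorization (STerm.leaf : STerm ar)) where
  default := ⟨⟨STerm.leaf, fun _ => STerm.leaf⟩, rfl⟩
  uniq := by
    rintro ⟨⟨y, w⟩, h⟩
    cases y with
    | leaf =>
      refine Subtype.ext ?_
      change (⟨STerm.leaf, w⟩ : Σ y : STerm ar, (Fin y.arity → STerm ar)) = ⟨STerm.leaf, _⟩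
      congr 1
      funext i
      rw [show i = (0 : Fin 1) from Subsingleton.elim (α := Fin 1) i 0]
      exact h
    | node s' ys => simp [STerm.graft] at h

theorem Factorization.finite (x : STerm ar) : Finite (Factorization x) := by
  induction x with
  | leaf => infer_instance
  | node s ts ih => exact Finite.of_equiv _ (Factorization.equiv s ts)

noncomputable instance (x : STerm ar) : Fintype (Factorization x) :=
  haveI := Factorization.finite x
  Fintype.ofFinite _

/-- The multiset of pairs `(y, rd w)` for `x = y[w]`. -/
noncomputable def termCuts (x : STerm ar) : Multiset (STerm ar × List (NTerm ar)) :=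
  (Finset.univ : Finset (Factorization x)).val.map fun c => (c.1.1, rd (List.ofFn c.1.2))

theorem univ_map_equiv {α β γ : Type*} [Fintype α] [Fintype β] (e : α ≃ β) (f : β → γ) :
    (Finset.univ : Finset β).val.map f = (Finset.univ : Finset α).val.map fun a => f (e a) := by
  rw [← Finset.map_univ_equiv e, Finset.map_val, Multiset.map_map]; rfl

theorem univ_map_option {α γ : Type*} [Fintype α] (f : Option α → γ) :
    (Finset.univ : Finset (Option α)).val.map f =
      f none ::ₘ (Finset.univ : Finset α).val.map fun a => f (some a) := by
  rw [univ_option, Finset.insertNone]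
  simp

theorem univ_map_prod {α β γ : Type*} [Fintype α] [Fintype β] (f : α × β → γ) :
    (Finset.univ : Finset (α × β)).val.map f =
      (Finset.univ : Finset α).val.bind fun a =>
        (Finset.univ : Finset β).val.map fun b => f (a, b) := by
  rw [← Finset.univ_product_univ, Finset.product_val]
  simp [SProd.sprod, Multiset.product, Multiset.map_bind]

theorem cutSeq_univ {T Y : Type*} {n : ℕ} (α : Fin n → Type*) [∀ i, Fintype (α i)]
    [Fintype (∀ i, α i)] (F : ∀ i, α i → T × List Y) :
    (cutSeq n fun i => (Finset.univ : Finset (α i)).val.map (F i)) =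
      (Finset.univ : Finset (∀ i, α i)).val.map fun c =>
        (fun i => (F i (c i)).1, (List.ofFn fun i => (F i (c i)).2).flatten) := by
  induction n with
  | zero =>
    have : (Finset.univ : Finset (∀ i, α i)) = {fun i => i.elim0} := by
      ext c
      simp only [Finset.mem_univ, Finset.mem_singleton, true_iff]
      exact funext fun i => i.elim0
    rw [this]
    simp only [cutSeq, Finset.singleton_val, Multiset.map_singleton]
    congr 2
    exact funext fun i => i.elim0
  | succ n ih =>
    classical
    rw [univ_map_equiv (Fin.consEquiv α), univ_map_prod]
    simp only [cutSeq, ih (fun i => α i.succ) (fun i => F i.succ), Multiset.bind_map,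
      Multiset.map_map, Function.comp_def]
    refine Multiset.bind_congr fun a _ => Multiset.map_congr rfl fun b _ => ?_
    simp only [Fin.consEquiv, Equiv.coe_fn_mk, List.ofFn_succ, List.flatten_cons, Fin.cons_zero,
      Fin.cons_succ, Prod.mk.injEq, and_true]
    funext i
    cases i using Fin.cases <;> rfl

theorem ofFn_finSigma_aux {α : Type*} {n : ℕ} {m : Fin n → ℕ} (w : (Σ i, Fin (m i)) → α)
    (u : Fin (∑ i, m i) → α) (h : ∀ p, u (finSigmaFinEquiv p) = w p) :
    List.ofFn u = (List.ofFn fun i => List.ofFn fun j => w ⟨i, j⟩).flatten := by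
  induction n with
  | zero => simp
  | succ n ih =>
    have hs := Fin.sum_univ_castSucc m
    rw [List.ofFn_congr hs u, List.ofFn_add, List.ofFn_succ', List.concat_eq_append,
      List.flatten_append, List.flatten_singleton]
    congr 1
    · apply ih (m := fun i => m i.castSucc) (fun p => w ⟨p.1.castSucc, p.2⟩)
      rintro ⟨i, j⟩
      rw [← h]
      congr 1
      apply Fin.ext
      simp [finSigmaFinEquiv_apply]
    · congr 1
      funext j
      rw [← h]
      congr 1
      apply Fin.ext
      simp [finSigmaFinEquiv_apply]
      rfl

theorem ofFn_finSigma {α : Type*} {n : ℕ} {m : Fin n → ℕ} (w : (Σ i, Fin (m i)) → α) :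
    (List.ofFn fun k => w (finSigmaFinEquiv.symm k)) =
      (List.ofFn fun i => List.ofFn fun j => w ⟨i, j⟩).flatten :=
  ofFn_finSigma_aux w _ fun p => by rw [Equiv.symm_apply_apply]

theorem termCuts_leaf : termCuts (STerm.leaf : STerm ar) = {(STerm.leaf, [])} := by
  have : (Finset.univ : Finset (Factorization (STerm.leaf : STerm ar))) = {default} := by
    ext c
    simp [Unique.eq_default c]
  unfold termCuts
  rw [this]
  simp only [Finset.singleton_val, Multiset.map_singleton]
  congr 2
  exact rd_leaf

theorem termCuts_node (s : S) (ts : Fin (ar s) → STerm ar) :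
    termCuts (STerm.node s ts) = (STerm.leaf, [⟨STerm.node s ts, by simp⟩]) ::ₘ
      (cutSeq (ar s) fun i => termCuts (ts i)).map fun p => (STerm.node s p.1, p.2) := by
  classical
  unfold termCuts
  rw [univ_map_equiv (Factorization.equiv s ts), univ_map_option, cutSeq_univ, Multiset.map_map]
  congr 1
  · simp only [Factorization.equiv, Equiv.ofBijective_apply, Factorization.build]
    congr 1
    exact rd_node s ts
  · refine Multiset.map_congr rfl fun c _ => ?_
    simp only [Factorization.equiv, Equiv.ofBijective_apply, Factorization.build,
      Function.comp_def]
    congr 1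
    have := ofFn_finSigma (m := fun i => (c i).1.1.arity) fun q => (c q.1).1.2 q.2
    refine (congrArg rd this).trans ?_
    rw [rd_flatten, List.map_ofFn]
    rfl

variable (ar) in
/-- The system of cuts of terms. -/
noncomputable def termSystem : CutSystem (STerm ar) (NTerm ar) where
  leaf := STerm.leaf
  inc := Subtype.val
  toWord t := rd [t]
  cuts := termCuts
  deg := STerm.deg
  toWord_leaf := rd_leaf
  toWord_inc := rd_val
  cuts_leaf := termCuts_leaf
  deg_leaf := rfl
  ind := by
    intro P h0 h1 t
    induction t with
    | leaf => exact h0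
    | node s ts ih =>
      exact h1 (ar s) (fun us => ⟨STerm.node s us, by simp⟩) (fun us => termCuts_node s us)
        (fun us => rfl) ts ih

theorem natCoprod_E (f : List (NTerm ar)) :
    natCoprod ar K (E K f) = sumE (cutWord (termSystem ar).letterCuts f) := by
  induction f with
  | nil => simp [natCoprod, liftWord_E, cutWord, sumE_nil]
  | cons x f ih =>
    have e : natCoprod ar K (E K [x]) = sumE ((termSystem ar).letterCuts x) := by
      rw [natCoprod, liftWord_E]
      simp only [List.map_cons, List.map_nil, List.prod_cons, List.prod_nil, mul_one]
      rw [coprodTerm, finsum_eq_sum_of_fintype, sumE, CutSystem.letterCuts, Multiset.map_map]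
      simp only [termSystem, termCuts, Multiset.map_map, Function.comp_def, Finset.sum]
    have h : x :: f = [x] ++ f := rfl
    rw [h, E_append, map_mul, e, ih, List.singleton_append, cutWord, sumE_mul]

/-- The natural Hopf algebra of the free operad. -/
noncomputable instance : HopfAlgebra K (NatFree ar K) :=
  (termSystem ar).hopf (natCoprod ar K) (natCoprod_E K)

theorem comul_natFree (x : NatFree ar K) : Coalgebra.comul x = natCoprod ar K x := rfl

end Terms

/-! ### Nodes of forests -/

section Nodes

/-- The nodes of a forest (a word of trees), given the nodes of each tree. -/
inductive ForestNode {X : Type*} (Nd : X → Type*) : List X → Type _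
  | here {t : X} {f : List X} (x : Nd t) : ForestNode Nd (t :: f)
  | there {t : X} {f : List X} (x : ForestNode Nd f) : ForestNode Nd (t :: f)

/-- A relation between the nodes of each tree, seen on the nodes of a forest (nodes of different
trees are not related). -/
inductive ForestNode.Rel {X : Type*} {Nd : X → Type*} (R : ∀ t : X, Nd t → Nd t → Prop) :
    {f : List X} → ForestNode Nd f → ForestNode Nd f → Prop
  | here {t : X} {f : List X} {x y : Nd t} (h : R t x y) :
      Rel R (.here x : ForestNode Nd (t :: f)) (.here y)
  | there {t : X} {f : List X} {x y : ForestNode Nd f} (h : Rel R x y) :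
      Rel R (.there x : ForestNode Nd (t :: f)) (.there y)

end Nodes

/-! ### Trimmed forests -/

section Trimmed
variable {S : Type*} (ar : S → ℕ)

/-- Nonempty planar rooted trees such that each node is decorated by an element `s` of `S` and has
at most `ar s` children. Trimmed forests are the words of trimmed trees, that is, the elements of
`List (TrimTree ar)`. -/
inductive TrimTree : Type _
  | node (s : S) (k : ℕ) (hk : k ≤ ar s) (ts : Fin k → TrimTree) : TrimTree

variable {ar}

namespace TrimTree

/-- The tree with root decorated by `s` attached to a forest. -/
def graftRoot (s : S) (f : List (TrimTree ar)) (hf : f.length ≤ ar s) : TrimTree ar :=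
  node s f.length hf f.get

/-- The nodes of a trimmed tree. -/
inductive Node : TrimTree ar → Type _
  | root (s : S) (k : ℕ) (hk : k ≤ ar s) (ts : Fin k → TrimTree ar) : Node (node s k hk ts)
  | child (s : S) (k : ℕ) (hk : k ≤ ar s) (ts : Fin k → TrimTree ar) (i : Fin k)
      (x : Node (ts i)) : Node (node s k hk ts)

/-- `Anc t x y` means that the node `x` is a (proper) ancestor of the node `y`, that is, `y` is a
(proper) descendant of `x`. -/
inductive Anc : (t : TrimTree ar) → Node t → Node t → Prop
  | root (s : S) (k : ℕ) (hk : k ≤ ar s) (ts : Fin k → TrimTree ar) (i : Fin k)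
      (y : Node (ts i)) : Anc (node s k hk ts) (.root s k hk ts) (.child s k hk ts i y)
  | child (s : S) (k : ℕ) (hk : k ≤ ar s) (ts : Fin k → TrimTree ar) (i : Fin k)
      (x y : Node (ts i)) (h : Anc (ts i) x y) :
      Anc (node s k hk ts) (.child s k hk ts i x) (.child s k hk ts i y)

theorem reduceOption_ofFn_length {X : Type*} {k n : ℕ} (hk : k ≤ n) (us : Fin k → Option X) :
    (List.ofFn us).reduceOption.length ≤ n :=
  (List.reduceOption_length_le _).trans (by simpa using hk)

open Classical in
/-- The restriction of a tree to a set `I` of nodes, where only the nodes of `I` and the edges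
between them are kept: the connected component of the root of the tree (`none` if the root does not
belong to `I`), and the word of the other components, ordered by the preorder of their roots. -/
noncomputable def split : (t : TrimTree ar) → Set (Node t) →
    Option (TrimTree ar) × List (TrimTree ar)
  | node s k hk ts, I =>
    let r : Fin k → Option (TrimTree ar) × List (TrimTree ar) :=
      fun i => (ts i).split {x | Node.child s k hk ts i x ∈ I}
    if Node.root s k hk ts ∈ I then
      (some (graftRoot s (List.ofFn fun i => (r i).1).reduceOption
        (reduceOption_ofFn_length hk _)), (List.ofFn fun i => (r i).2).flatten)
    else (none, (List.ofFn fun i => (r i).1.toList ++ (r i).2).flatten)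

/-- The restriction of a tree to a set of nodes, as a forest. -/
noncomputable def restrict (t : TrimTree ar) (I : Set (Node t)) : List (TrimTree ar) :=
  (t.split I).1.toList ++ (t.split I).2

end TrimTree

/-- The nodes of a trimmed forest. -/
abbrev TrimNode (f : List (TrimTree ar)) : Type _ := ForestNode TrimTree.Node f

/-- The ancestor relation on the nodes of a trimmed forest. -/
abbrev TrimAnc {f : List (TrimTree ar)} (x y : TrimNode f) : Prop :=
  ForestNode.Rel TrimTree.Anc x y

/-- The restriction of a trimmed forest to a set of nodes. -/
noncomputable def restrictForest : (f : List (TrimTree ar)) → Set (TrimNode f) → List (TrimTree ar)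
  | [], _ => []
  | t :: f, I => t.restrict {x | ForestNode.here x ∈ I} ++
      restrictForest f {x | ForestNode.there x ∈ I}

/-- Admissible pairs `(I₁, I₂)` of sets of nodes of `f`: every node belongs to exactly one of the
two sets, `I₁` is closed under ancestors and `I₂` is closed under descendants. -/
structure Admissible (f : List (TrimTree ar)) (I : Set (TrimNode f) × Set (TrimNode f)) : Prop where
  union : I.1 ∪ I.2 = Set.univ
  disjoint : Disjoint I.1 I.2
  ancestors : ∀ x ∈ I.1, ∀ y, TrimAnc y x → y ∈ I.1
  descendants : ∀ x ∈ I.2, ∀ y, TrimAnc x y → y ∈ I.2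

variable (ar) in
/-- The underlying algebra of the noncommutative Connes–Kreimer Hopf algebra of trimmed forests:
the span of the trimmed forests, with the concatenation product. -/
abbrev NCK (K : Type*) [Field K] : Type _ := WordAlg K (TrimTree ar)

variable (K : Type*) [Field K]

variable (ar) in
/-- The coproduct `Δ E_f = ∑ E_{f(I₁)} ⊗ E_{f(I₂)}`, where `(I₁, I₂)` runs over the admissible
pairs of sets of nodes of `f` (a finite sum). -/
noncomputable def nckCoprod : NCK ar K →ₗ[K] NCK ar K ⊗[K] NCK ar K :=
  (eBasis K (TrimTree ar)).constr K fun f =>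
    ∑ᶠ I : {I : Set (TrimNode f) × Set (TrimNode f) // Admissible f I},
      E K (restrictForest f I.1.1) ⊗ₜ[K] E K (restrictForest f I.1.2)

/-! Auxiliary: recursive description of the admissible pairs. -/

namespace TrimTree

/-- Sets of nodes closed under ancestors. -/
def Up (t : TrimTree ar) : Type _ := {I : Set (Node t) // ∀ x ∈ I, ∀ y, Anc t y x → y ∈ I}

theorem anc_child_iff {s : S} {k : ℕ} {hk : k ≤ ar s} {ts : Fin k → TrimTree ar} {i : Fin k}
    {x : Node (ts i)} {y : Node (node s k hk ts)} :
    Anc _ y (.child s k hk ts i x) ↔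
      y = .root s k hk ts ∨ ∃ z, y = .child s k hk ts i z ∧ Anc (ts i) z x := by
  constructor
  · intro h
    cases h with
    | root => exact Or.inl rfl
    | child _ _ _ _ _ z _ h => exact Or.inr ⟨z, rfl, h⟩
  · rintro (rfl | ⟨z, rfl, h⟩)
    · exact .root ..
    · exact .child _ _ _ _ _ _ _ h

theorem not_anc_root {s : S} {k : ℕ} {hk : k ≤ ar s} {ts : Fin k → TrimTree ar}
    {y : Node (node s k hk ts)} : ¬ Anc _ y (.root s k hk ts) := by
  intro h; cases h

/-- The set of nodes made of the root and of given sets of nodes of the children. -/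
def rootSet {s : S} {k : ℕ} (hk : k ≤ ar s) {ts : Fin k → TrimTree ar}
    (c : ∀ i, Set (Node (ts i))) : Set (Node (node s k hk ts)) :=
  {x | match x with
    | .root _ _ _ _ => True
    | .child _ _ _ _ i y => y ∈ c i}

/-- Sets closed under ancestors, from the ones of the children. -/
def Up.build (s : S) (k : ℕ) (hk : k ≤ ar s) (ts : Fin k → TrimTree ar) :
    Option (∀ i, Up (ts i)) → Up (node s k hk ts)
  | none => ⟨∅, fun _ h => h.elim⟩
  | some c => ⟨rootSet hk fun i => (c i).1, by
      rintro x hx y hy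
      cases x with
      | root => exact (not_anc_root hy).elim
      | child _ _ _ _ i x =>
        rcases anc_child_iff.1 hy with rfl | ⟨z, rfl, h⟩
        · exact trivial
        · exact (c i).2 x hx z h⟩

theorem Up.build_bijective (s : S) (k : ℕ) (hk : k ≤ ar s) (ts : Fin k → TrimTree ar) :
    Function.Bijective (Up.build s k hk ts) := by
  constructor
  · intro c d h
    have h' := fun x => Set.ext_iff.1 (congrArg Subtype.val h) x
    cases c with
    | none =>
      cases d with
      | none => rfl
      | some d => exact ((h' (.root s k hk ts)).2 trivial).elim
    | some c =>
      cases d with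
      | none => exact ((h' (.root s k hk ts)).1 trivial).elim
      | some d =>
        congr 1
        funext i
        exact Subtype.ext (Set.ext fun x => h' (.child s k hk ts i x))
  · intro I
    by_cases hr : Node.root s k hk ts ∈ I.1
    · refine ⟨some fun i => ⟨{x | Node.child s k hk ts i x ∈ I.1}, fun x hx y hy =>
        I.2 _ hx _ (.child _ _ _ _ _ _ _ hy)⟩, Subtype.ext (Set.ext fun x => ?_)⟩
      cases x with
      | root => exact ⟨fun _ => hr, fun _ => trivial⟩
      | child _ _ _ _ i x => exact Iff.rfl
    · refine ⟨none, Subtype.ext (Set.ext fun x => ⟨fun h => h.elim, fun hx => hr ?_⟩)⟩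
      cases x with
      | root => exact hx
      | child _ _ _ _ i x => exact I.2 _ hx _ (.root ..)

/-- Recursive description of the sets of nodes closed under ancestors, as an equivalence. -/
noncomputable def Up.equiv (s : S) (k : ℕ) (hk : k ≤ ar s) (ts : Fin k → TrimTree ar) :
    Option (∀ i, Up (ts i)) ≃ Up (node s k hk ts) :=
  Equiv.ofBijective _ (Up.build_bijective s k hk ts)

theorem Up.finite (t : TrimTree ar) : Finite (Up t) := by
  induction t with
  | node s k hk ts ih => exact Finite.of_equiv _ (Up.equiv s k hk ts)

noncomputable instance upFintype (t : TrimTree ar) : Fintype (Up t) :=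
  haveI := Up.finite t
  Fintype.ofFinite _

theorem split_empty (t : TrimTree ar) : t.split ∅ = (none, []) := by
  induction t with
  | node s k hk ts ih =>
    simp [split, ih]

theorem graftRoot_ofFn (s : S) (k : ℕ) (hk : k ≤ ar s) (ts : Fin k → TrimTree ar)
    (f : List (TrimTree ar)) (hf : f.length ≤ ar s) (h : f = List.ofFn ts) :
    graftRoot s f hf = node s k hk ts := by
  subst h
  unfold graftRoot
  have : ∀ (n : ℕ) (e : n = k) (hn : n ≤ ar s) (us : Fin n → TrimTree ar),
      (∀ i, us i = ts (Fin.cast e i)) → node s n hn us = node s k hk ts := by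
    rintro n rfl hn us h
    congr 1
    exact funext h
  refine this _ (List.length_ofFn) _ _ fun i => ?_
  simp [List.get_eq_getElem]
  rfl

theorem reduceOption_ofFn_some {X : Type*} {k : ℕ} (ts : Fin k → X) :
    (List.ofFn fun i => some (ts i)).reduceOption = List.ofFn ts := by
  induction k with
  | zero => rfl
  | succ k ih =>
    rw [List.ofFn_succ, List.ofFn_succ, List.reduceOption_cons_of_some, ih]

theorem split_univ (t : TrimTree ar) : t.split Set.univ = (some t, []) := by
  induction t with
  | node s k hk ts ih =>
    simp only [split, Set.mem_univ, Set.ofPred_true, ih, if_true]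
    congr 1
    · congr 1
      exact graftRoot_ofFn _ _ _ _ _ _ (reduceOption_ofFn_some ts)
    · simp

theorem split_up (t : TrimTree ar) (I : Up t) : (t.split I.1).2 = [] := by
  induction t with
  | node s k hk ts ih =>
    obtain ⟨c, rfl⟩ := (Up.build_bijective s k hk ts).2 I
    cases c with
    | none => exact congrArg Prod.snd (split_empty _)
    | some c =>
      have h : Node.root s k hk ts ∈ (Up.build s k hk ts (some c)).1 := trivial
      simp only [split, if_pos h]
      have : ∀ i, (split (ts i) {x | Node.child s k hk ts i x ∈
          (Up.build s k hk ts (some c)).1}).2 = [] := fun i => ih i (c i)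
      simp [this]

/-- The pairs (component of the root, complement) for the sets closed under ancestors. -/
noncomputable def treeCuts (t : TrimTree ar) :
    Multiset (Option (TrimTree ar) × List (TrimTree ar)) :=
  (Finset.univ : Finset (Up t)).val.map fun I => ((t.split I.1).1, t.restrict I.1ᶜ)

theorem treeCuts_node (s : S) (k : ℕ) (hk : k ≤ ar s) (ts : Fin k → TrimTree ar) :
    treeCuts (node s k hk ts) = (none, [node s k hk ts]) ::ₘ
      (cutSeq k fun i => treeCuts (ts i)).map fun p =>
        (some (graftRoot s (List.ofFn p.1).reduceOption (reduceOption_ofFn_length hk _)), p.2) := by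
  classical
  unfold treeCuts
  rw [univ_map_equiv (Up.equiv s k hk ts), univ_map_option, cutSeq_univ, Multiset.map_map]
  congr 1
  · simp only [Up.equiv, Equiv.ofBijective_apply, Up.build, Set.compl_empty, restrict, split_univ,
      split_empty]
    rfl
  · refine Multiset.map_congr rfl fun c _ => ?_
    have h : Node.root s k hk ts ∈ (Up.build s k hk ts (some c)).1 := trivial
    have h' : Node.root s k hk ts ∉ (Up.build s k hk ts (some c)).1ᶜ := fun h' => h' h
    simp only [Up.equiv, Equiv.ofBijective_apply, restrict, split, if_pos h, if_neg h',
      Function.comp_def]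
    rfl

/-- Cuts of a possibly empty tree. -/
noncomputable def optCuts : Option (TrimTree ar) →
    Multiset (Option (TrimTree ar) × List (TrimTree ar))
  | none => {(none, [])}
  | some t => treeCuts t

theorem cutSeq_optCuts {k : ℕ} (us : Fin k → Option (TrimTree ar)) :
    (cutSeq k fun i => optCuts (us i)).map
        (fun p => ((List.ofFn p.1).reduceOption, p.2)) =
      cutWord (fun t => (treeCuts t).map fun p => (p.1.toList, p.2))
        (List.ofFn us).reduceOption := by
  induction k with
  | zero => simp [cutSeq, cutWord]
  | succ k ih =>
    have ih' := ih fun i => us i.succ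
    rw [List.ofFn_succ]
    have key : ∀ m : Multiset (Option (TrimTree ar) × List (TrimTree ar)),
        (m.bind fun p => (cutSeq k fun i => optCuts (us i.succ)).map fun q =>
          ((List.ofFn (Fin.cons p.1 q.1 : Fin (k + 1) → Option (TrimTree ar))).reduceOption,
            p.2 ++ q.2)) =
        m.bind fun p => (cutWord (fun t => (treeCuts t).map fun p => (p.1.toList, p.2))
          (List.ofFn fun i => us i.succ).reduceOption).map fun q =>
            (p.1.toList ++ q.1, p.2 ++ q.2) := by
      intro m
      refine Multiset.bind_congr fun p _ => ?_
      rw [← ih', Multiset.map_map]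
      refine Multiset.map_congr rfl fun q _ => ?_
      simp only [List.ofFn_succ, Fin.cons_zero, Fin.cons_succ, Function.comp_def]
      congr 1
      cases p.1 <;> simp
    simp only [cutSeq, Multiset.map_bind, Multiset.map_map, Function.comp_def, key]
    cases us 0 with
    | none => simp [optCuts]
    | some t => simp [optCuts, cutWord, Multiset.bind_map]

theorem optCuts_graftRoot (s : S) (f : List (TrimTree ar)) (hf : f.length ≤ ar s) :
    optCuts (some (graftRoot s f hf)) = (none, [graftRoot s f hf]) ::ₘ
      (cutWord (fun t => (treeCuts t).map fun p => (p.1.toList, p.2)) f).map fun p =>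
        (if h : p.1.length ≤ ar s then some (graftRoot s p.1 h) else none, p.2) := by
  have e : f = (List.ofFn fun i => some (f.get i)).reduceOption := by
    rw [reduceOption_ofFn_some, List.ofFn_get]
  rw [show ∀ c : TrimTree ar → Multiset (List (TrimTree ar) × List (TrimTree ar)),
    cutWord c f = cutWord c (List.ofFn fun i => some (f.get i)).reduceOption from
      fun c => congrArg _ e, ← cutSeq_optCuts, Multiset.map_map]
  simp only [optCuts]
  rw [graftRoot, treeCuts_node]
  congr 1
  refine Multiset.map_congr rfl fun p _ => ?_
  simp only [Function.comp_def]
  rw [dif_pos (reduceOption_ofFn_length hf _)]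

theorem optCuts_node (s : S) {k : ℕ} (hk : k ≤ ar s) (us : Fin k → Option (TrimTree ar)) :
    optCuts (some (graftRoot s (List.ofFn us).reduceOption (reduceOption_ofFn_length hk us))) =
      (none, [graftRoot s (List.ofFn us).reduceOption (reduceOption_ofFn_length hk us)]) ::ₘ
        (cutSeq k fun i => optCuts (us i)).map fun p =>
          (some (graftRoot s (List.ofFn p.1).reduceOption (reduceOption_ofFn_length hk _)),
            p.2) := by
  rw [optCuts_graftRoot, ← cutSeq_optCuts, Multiset.map_map]
  congr 1
  refine Multiset.map_congr rfl fun p _ => ?_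
  simp only [Function.comp_def]
  rw [dif_pos (reduceOption_ofFn_length hk _)]

/-- The number of nodes. -/
def deg : TrimTree ar → ℕ
  | node _ _ _ ts => 1 + ∑ i, (ts i).deg

/-- The number of nodes of a possibly empty tree. -/
def optDeg : Option (TrimTree ar) → ℕ
  | none => 0
  | some t => t.deg

theorem sum_reduceOption {k : ℕ} (us : Fin k → Option (TrimTree ar)) :
    ((List.ofFn us).reduceOption.map deg).sum = ∑ i, optDeg (us i) := by
  induction k with
  | zero => simp
  | succ k ih =>
    rw [List.ofFn_succ, Fin.sum_univ_succ, ← ih]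
    cases us 0 <;> simp [optDeg]

theorem optDeg_node (s : S) {k : ℕ} (hk : k ≤ ar s) (us : Fin k → Option (TrimTree ar)) :
    optDeg (some (graftRoot s (List.ofFn us).reduceOption (reduceOption_ofFn_length hk us))) =
      1 + ∑ i, optDeg (us i) := by
  rw [← sum_reduceOption, optDeg, graftRoot, deg, ← List.sum_ofFn]
  congr 2
  conv_rhs => rw [← List.ofFn_get (List.ofFn us).reduceOption, List.map_ofFn]
  rfl

variable (ar) in
/-- The system of cuts of trimmed trees. -/
noncomputable def trimSystem : CutSystem (Option (TrimTree ar)) (TrimTree ar) where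
  leaf := none
  inc := some
  toWord := Option.toList
  cuts := optCuts
  deg := optDeg
  toWord_leaf := rfl
  toWord_inc _ := rfl
  cuts_leaf := rfl
  deg_leaf := rfl
  ind := by
    intro P h0 h1 t
    cases t with
    | none => exact h0
    | some t =>
      induction t with
      | node s k hk ts ih =>
        have := h1 k _ (optCuts_node s hk) (optDeg_node s hk) (fun i => some (ts i)) ih
        rwa [graftRoot_ofFn s k hk ts _ _ (reduceOption_ofFn_some ts)] at this

end TrimTree

/-- Sets of nodes of a forest closed under ancestors. -/
def UpForest (f : List (TrimTree ar)) : Type _ :=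
  {I : Set (TrimNode f) // ∀ x ∈ I, ∀ y, TrimAnc y x → y ∈ I}

theorem rel_here_iff {t : TrimTree ar} {f : List (TrimTree ar)} {x : t.Node}
    {y : TrimNode (t :: f)} :
    TrimAnc y (ForestNode.here x) ↔ ∃ z, y = ForestNode.here z ∧ TrimTree.Anc t z x := by
  constructor
  · intro h
    cases h with
    | here h => exact ⟨_, rfl, h⟩
  · rintro ⟨z, rfl, h⟩
    exact .here h

theorem rel_there_iff {t : TrimTree ar} {f : List (TrimTree ar)} {x : TrimNode f}
    {y : TrimNode (t :: f)} :
    TrimAnc y (ForestNode.there x) ↔ ∃ z, y = ForestNode.there z ∧ TrimAnc z x := by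
  constructor
  · intro h
    cases h with
    | there h => exact ⟨_, rfl, h⟩
  · rintro ⟨z, rfl, h⟩
    exact .there h

/-- A set of nodes of a forest, tree by tree. -/
def consSet {t : TrimTree ar} {f : List (TrimTree ar)} (I : Set t.Node) (J : Set (TrimNode f)) :
    Set (TrimNode (t :: f)) :=
  {x | match x with
    | .here y => y ∈ I
    | .there y => y ∈ J}

/-- Decomposition of the sets closed under ancestors, tree by tree. -/
def UpForest.equivCons (t : TrimTree ar) (f : List (TrimTree ar)) :
    t.Up × UpForest f ≃ UpForest (t :: f) where
  toFun p := ⟨consSet p.1.1 p.2.1, by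
    intro x hx y hy
    cases x with
    | here x =>
      obtain ⟨z, rfl, h⟩ := rel_here_iff.1 hy
      exact p.1.2 x hx z h
    | there x =>
      obtain ⟨z, rfl, h⟩ := rel_there_iff.1 hy
      exact p.2.2 x hx z h⟩
  invFun I := (⟨{x | ForestNode.here x ∈ I.1}, fun _ hx _ hy => I.2 _ hx _ (.here hy)⟩,
    ⟨{x | ForestNode.there x ∈ I.1}, fun _ hx _ hy => I.2 _ hx _ (.there hy)⟩)
  left_inv _ := rfl
  right_inv _ := by
    refine Subtype.ext (Set.ext fun x => ?_)
    cases x <;> exact Iff.rfl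

instance : Unique (UpForest ([] : List (TrimTree ar))) where
  default := ⟨∅, fun _ h => h.elim⟩
  uniq _ := Subtype.ext (Set.ext fun x => nomatch x)

theorem UpForest.finite (f : List (TrimTree ar)) : Finite (UpForest f) := by
  induction f with
  | nil => infer_instance
  | cons t f ih => exact Finite.of_equiv _ (UpForest.equivCons t f)

noncomputable instance (f : List (TrimTree ar)) : Fintype (UpForest f) :=
  haveI := UpForest.finite f
  Fintype.ofFinite _

/-- Admissible pairs are determined by their first component. -/
def UpForest.equivAdmissible (f : List (TrimTree ar)) :
    UpForest f ≃ {I : Set (TrimNode f) × Set (TrimNode f) // Admissible f I} where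
  toFun I := ⟨(I.1, I.1ᶜ), Set.union_compl_self _, disjoint_compl_right, I.2,
    fun _ hx _ hy h => hx (I.2 _ h _ hy)⟩
  invFun I := ⟨I.1.1, I.2.ancestors⟩
  left_inv _ := rfl
  right_inv I := by
    refine Subtype.ext (Prod.ext rfl ?_)
    have h : IsCompl I.1.1 I.1.2 := ⟨I.2.disjoint, codisjoint_iff.2 I.2.union⟩
    exact h.compl_eq

theorem forestCuts (f : List (TrimTree ar)) :
    ((Finset.univ : Finset (UpForest f)).val.map fun I =>
      (restrictForest f I.1, restrictForest f I.1ᶜ)) =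
    cutWord (TrimTree.trimSystem ar).letterCuts f := by
  induction f with
  | nil =>
    have : (Finset.univ : Finset (UpForest ([] : List (TrimTree ar)))) = {default} := by
      ext c
      simp [Unique.eq_default c]
    rw [this]
    rfl
  | cons t f ih =>
    rw [univ_map_equiv (UpForest.equivCons t f), univ_map_prod, cutWord, ← ih]
    simp only [CutSystem.letterCuts, TrimTree.trimSystem, TrimTree.optCuts, TrimTree.treeCuts,
      Multiset.map_map, Multiset.bind_map, Function.comp_def]
    refine Multiset.bind_congr fun I _ => Multiset.map_congr rfl fun J _ => ?_
    simp only [restrictForest]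
    refine Prod.ext ?_ rfl
    change t.restrict I.1 ++ _ = (t.split I.1).1.toList ++ _
    rw [TrimTree.restrict, TrimTree.split_up, List.append_nil]
    rfl

theorem nckCoprod_E (f : List (TrimTree ar)) :
    nckCoprod ar K (E K f) = sumE (cutWord (TrimTree.trimSystem ar).letterCuts f) := by
  rw [nckCoprod, ← eBasis_apply, Module.Basis.constr_basis,
    ← finsum_comp_equiv (UpForest.equivAdmissible f), finsum_eq_sum_of_fintype, ← forestCuts,
    sumE, Multiset.map_map]
  rfl

variable (ar) in
/-- The coproduct, as an algebra morphism. -/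
noncomputable def nckCoprodAlgHom : NCK ar K →ₐ[K] NCK ar K ⊗[K] NCK ar K :=
  AlgHom.ofLinearMap (nckCoprod ar K)
    (by rw [← E_nil, nckCoprod_E, cutWord, sumE_nil])
    (by
      intro x y
      revert x
      refine word_induction (fun f => ?_) (fun a b ha hb => ?_) (fun c a ha => ?_)
      · revert y
        refine word_induction (fun g => ?_) (fun a b ha hb => ?_) (fun c a ha => ?_)
        · rw [← E_append, nckCoprod_E, nckCoprod_E, nckCoprod_E, cutWord_append, sumE_mul]
        · rw [mul_add, map_add, map_add, ha, hb, mul_add]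
        · rw [mul_smul_comm, map_smul, map_smul, ha, mul_smul_comm]
      · rw [add_mul, map_add, map_add, ha, hb, add_mul]
      · rw [smul_mul_assoc, map_smul, map_smul, ha, smul_mul_assoc])

/-- The noncommutative Connes–Kreimer Hopf algebra of trimmed forests. -/
noncomputable instance : HopfAlgebra K (NCK ar K) :=
  (TrimTree.trimSystem ar).hopf (nckCoprodAlgHom ar K) (nckCoprod_E K)

theorem comul_nck (x : NCK ar K) : Coalgebra.comul x = nckCoprod ar K x := rfl

end Trimmed

/-! ### Trimming -/

section Trim
variable {S : Type*} {ar : S → ℕ}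

/-- Removal of the leaves of a term: the leaf gives nothing, and the other terms give a trimmed
tree. -/
def STerm.tr : STerm ar → Option (TrimTree ar)
  | leaf => none
  | node s ts => some (TrimTree.graftRoot s (List.ofFn fun i => (ts i).tr).reduceOption
      (TrimTree.reduceOption_ofFn_length le_rfl _))

/-- The trimmed forest `tr f` obtained by removing the leaves of a reduced forest `f`. -/
def tr (f : List (NTerm ar)) : List (TrimTree ar) := f.filterMap fun t => t.1.tr

end Trim

/-! ### Forest-like alphabets and the realizing map -/

section Realization
variable {S : Type*}

/-- A forest-like alphabet on the set `S`: a set of letters with a root relation, decoration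
relations, and edge relations. -/
structure ForestLikeAlphabet (S : Type*) where
  Letter : Type*
  root : Set Letter
  deco : S → Set Letter
  edge : ℕ+ → Letter → Letter → Prop

namespace ForestLikeAlphabet

/-- The quotient of an alphabet by an equivalence relation. -/
def quotient (A : ForestLikeAlphabet S) (r : Setoid A.Letter) : ForestLikeAlphabet S where
  Letter := Quotient r
  root := {x | ∃ a ∈ A.root, Quotient.mk r a = x}
  deco s := {x | ∃ a ∈ A.deco s, Quotient.mk r a = x}
  edge j x y := ∃ a b, A.edge j a b ∧ Quotient.mk r a = x ∧ Quotient.mk r b = y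

variable (S) in
/-- The alphabet of positions: the letters are the `a^s_u` with `s ∈ S` and `u` a word on `ℕ`. -/
def positions : ForestLikeAlphabet S where
  Letter := S × List ℕ
  root := {a | ∃ l, a.2 = List.replicate l 0}
  deco s := {a | a.1 = s}
  edge j a b := ∃ l, b.2 = a.2 ++ [(j : ℕ)] ++ List.replicate l 0

variable (S) in
/-- The alphabet of lengths: the quotient of the alphabet of positions identifying `a^s_u` and
`a^s_v` when `u` and `v` have the same length. -/
def lengths : ForestLikeAlphabet S :=
  (positions S).quotient (Setoid.ker fun a : S × List ℕ => (a.1, a.2.length))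

end ForestLikeAlphabet

/-- The noncommutative polynomials on an alphabet: formal series in the words, of finite degree
and with a possibly infinite support. -/
def NCPoly (K : Type*) [Field K] (A : Type*) : Submodule K (List A → K) where
  carrier := {p | ∃ d : ℕ, ∀ w : List A, d < w.length → p w = 0}
  add_mem' := by
    rintro p q ⟨d, hd⟩ ⟨e, he⟩
    exact ⟨max d e, fun w hw => by
      rw [Pi.add_apply, hd w (lt_of_le_of_lt (le_max_left ..) hw),
        he w (lt_of_le_of_lt (le_max_right ..) hw), add_zero]⟩
  zero_mem' := ⟨0, fun _ _ => rfl⟩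
  smul_mem' := by
    rintro c p ⟨d, hd⟩
    exact ⟨d, fun w hw => by rw [Pi.smul_apply, hd w hw, smul_zero]⟩

variable {ar : S → ℕ}

namespace STerm

/-- The internal nodes of a term. -/
inductive Node : STerm ar → Type _
  | root (s : S) (ts : Fin (ar s) → STerm ar) : Node (node s ts)
  | child (s : S) (ts : Fin (ar s) → STerm ar) (i : Fin (ar s)) (x : Node (ts i)) : Node (node s ts)

/-- The decoration of an internal node. -/
def Node.deco : {t : STerm ar} → Node t → S
  | _, .root s _ => s
  | _, .child _ _ _ x => x.deco

/-- The property of being the root of the term. -/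
def Node.IsRoot : {t : STerm ar} → Node t → Prop
  | _, .root _ _ => True
  | _, .child _ _ _ _ => False

/-- `Edge j t x y` means that the node `y` is the `j`-th child of the node `x` in `t`. -/
inductive Edge (j : ℕ+) : (t : STerm ar) → Node t → Node t → Prop
  | root (s : S) (ts : Fin (ar s) → STerm ar) (i : Fin (ar s)) (hi : (j : ℕ) = i + 1)
      (y : Node (ts i)) (hy : y.IsRoot) : Edge j (node s ts) (.root s ts) (.child s ts i y)
  | child (s : S) (ts : Fin (ar s) → STerm ar) (i : Fin (ar s)) (x y : Node (ts i))
      (h : Edge j (ts i) x y) : Edge j (node s ts) (.child s ts i x) (.child s ts i y)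

/-- The word of the labels `a x` of the internal nodes `x`, listed in left to right preorder. -/
def preorder {L : Type*} : (t : STerm ar) → (Node t → L) → List L
  | leaf, _ => []
  | node s ts, a => a (.root s ts) ::
      (List.ofFn fun i => (ts i).preorder fun x => a (.child s ts i x)).flatten

theorem preorder_length {L : Type*} (t : STerm ar) (a : Node t → L) :
    (t.preorder a).length = t.deg := by
  induction t with
  | leaf => rfl
  | node s ts ih =>
    simp only [preorder, List.length_cons, List.length_flatten, List.map_ofFn, Function.comp_def,
      ih, List.sum_ofFn, deg]
    omega

end STerm

/-- The internal nodes of a reduced forest. -/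
abbrev NodeOf (f : List (NTerm ar)) : Type _ := ForestNode (fun t : NTerm ar => t.1.Node) f

/-- The decoration of an internal node of a reduced forest. -/
def NodeOf.deco : {f : List (NTerm ar)} → NodeOf f → S
  | _, .here x => x.deco
  | _, .there x => NodeOf.deco x

/-- The property of being one of the roots of the forest. -/
def NodeOf.IsRoot : {f : List (NTerm ar)} → NodeOf f → Prop
  | _, .here x => x.IsRoot
  | _, .there x => NodeOf.IsRoot x

/-- The node `y` is the `j`-th child of the node `x` in the forest. -/
abbrev NodeOf.Edge (j : ℕ+) {f : List (NTerm ar)} (x y : NodeOf f) : Prop :=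
  ForestNode.Rel (fun t : NTerm ar => STerm.Edge j t.1) x y

/-- The word of the labels of the internal nodes of a forest, listed in left to right preorder. -/
def preorderForest {L : Type*} : (f : List (NTerm ar)) → (NodeOf f → L) → List L
  | [], _ => []
  | t :: f, a => (t.1.preorder fun x => a (.here x)) ++ preorderForest f fun x => a (.there x)

/-- The degree (number of internal nodes) of a reduced forest. -/
def forestDeg (f : List (NTerm ar)) : ℕ := (f.map fun t => t.1.deg).sum

/-- The word `w` on the alphabet `A` is compatible with the reduced forest `f`: the length of `w` is
the number of internal nodes of `f` and, `a x` being the letter of `w` at the position of the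
node `x` in preorder, roots have their letter in the root relation, a node decorated by
`s` has its letter in the `s`-decoration relation, and the letters of a node and of its `j`-th
child are in the `j`-edge relation. -/
def Compatible (A : ForestLikeAlphabet S) (f : List (NTerm ar)) (w : List A.Letter) : Prop :=
  ∃ a : NodeOf f → A.Letter, preorderForest f a = w ∧
    (∀ x, NodeOf.IsRoot x → a x ∈ A.root) ∧
    (∀ x, a x ∈ A.deco (NodeOf.deco x)) ∧
    ∀ (j : ℕ+) (x y : NodeOf f), NodeOf.Edge j x y → A.edge j (a x) (a y)

theorem preorderForest_length {L : Type*} (f : List (NTerm ar)) (a : NodeOf f → L) :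
    (preorderForest f a).length = forestDeg f := by
  induction f with
  | nil => rfl
  | cons t f ih =>
    simp only [preorderForest, List.length_append, STerm.preorder_length, ih, forestDeg,
      List.map_cons, List.sum_cons]

theorem Compatible.length {A : ForestLikeAlphabet S} {f : List (NTerm ar)} {w : List A.Letter}
    (h : Compatible A f w) : w.length = forestDeg f := by
  obtain ⟨a, rfl, -⟩ := h
  exact preorderForest_length f a

variable (K : Type*) [Field K]

open Classical in
variable (ar) in
/-- The realizing map `r_A`, sending `E_f` to the sum of the words compatible with `f`. -/
noncomputable def realize (A : ForestLikeAlphabet S) : NatFree ar K →ₗ[K] NCPoly K A.Letter :=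
  (eBasis K (NTerm ar)).constr K fun f =>
    ⟨fun w => if Compatible A f w then 1 else 0, forestDeg f, fun w hw =>
      if_neg fun h => by rw [h.length] at hw; exact lt_irrefl _ hw⟩

/-! Auxiliary: the kernel of the realizing map is a two-sided ideal. -/

open Classical in
theorem realize_E (A : ForestLikeAlphabet S) (f : List (NTerm ar)) (w : List A.Letter) :
    (realize ar K A (E K f)).1 w = if Compatible A f w then 1 else 0 := by
  rw [realize, ← eBasis_apply, Module.Basis.constr_basis]

theorem compatible_cons {A : ForestLikeAlphabet S} {t : NTerm ar} {f : List (NTerm ar)}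
    {w : List A.Letter} :
    Compatible A (t :: f) w ↔ ∃ u v, w = u ++ v ∧ Compatible A [t] u ∧ Compatible A f v := by
  constructor
  · rintro ⟨a, rfl, h1, h2, h3⟩
    refine ⟨_, _, rfl, ⟨fun | .here x => a (.here x), ?_, ?_, ?_, ?_⟩,
      ⟨fun x => a (.there x), rfl, fun x hx => h1 (.there x) hx, fun x => h2 (.there x),
        fun j x y h => h3 j _ _ (.there h)⟩⟩
    · simp [preorderForest]
    · rintro (x | x) hx
      · exact h1 (.here x) hx
      · cases x
    · rintro (x | x)
      · exact h2 (.here x)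
      · cases x
    · rintro j _ _ (h | h)
      · exact h3 j _ _ (.here h)
      · cases h
  · rintro ⟨_, _, rfl, ⟨a, rfl, h1, h2, h3⟩, ⟨b, rfl, h1', h2', h3'⟩⟩
    refine ⟨fun | .here x => a (.here x) | .there x => b x, ?_, ?_, ?_, ?_⟩
    · simp [preorderForest]
    · rintro (x | x) hx
      · exact h1 (.here x) hx
      · exact h1' x hx
    · rintro (x | x)
      · exact h2 (.here x)
      · exact h2' x
    · rintro j _ _ (h | h)
      · exact h3 j _ _ (.here h)
      · exact h3' j _ _ h

theorem compatible_nil {A : ForestLikeAlphabet S} {w : List A.Letter} :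
    Compatible A ([] : List (NTerm ar)) w ↔ w = [] := by
  constructor
  · rintro ⟨a, rfl, -⟩
    rfl
  · rintro rfl
    refine ⟨(fun x => nomatch x), rfl, ?_, ?_, ?_⟩
    · intro x
      cases x
    · intro x
      cases x
    · intro _ x
      cases x

theorem compatible_append {A : ForestLikeAlphabet S} {f g : List (NTerm ar)} {w : List A.Letter} :
    Compatible A (f ++ g) w ↔ ∃ u v, w = u ++ v ∧ Compatible A f u ∧ Compatible A g v := by
  induction f generalizing w with
  | nil => simp [compatible_nil]
  | cons t f ih =>
    rw [List.cons_append, compatible_cons]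
    constructor
    · rintro ⟨u, v, rfl, h1, h2⟩
      obtain ⟨u', v', rfl, h3, h4⟩ := ih.1 h2
      exact ⟨u ++ u', v', by simp, compatible_cons.2 ⟨u, u', rfl, h1, h3⟩, h4⟩
    · rintro ⟨u, v, rfl, h1, h2⟩
      obtain ⟨u', v', rfl, h3, h4⟩ := compatible_cons.1 h1
      exact ⟨u', v' ++ v, by simp, h3, ih.2 ⟨v', v, rfl, h4, h2⟩⟩

theorem realize_E_mul (A : ForestLikeAlphabet S) (f : List (NTerm ar)) (w : List A.Letter)
    (x : NatFree ar K) : (realize ar K A (E K f * x)).1 w =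
      (realize ar K A (E K f)).1 (w.take (forestDeg f)) *
        (realize ar K A x).1 (w.drop (forestDeg f)) := by
  revert x
  refine word_induction (fun g => ?_) (fun a b ha hb => ?_) (fun c a ha => ?_)
  · rw [← E_append, realize_E, realize_E, realize_E, ite_mul, one_mul, zero_mul, ← ite_and]
    congr 1
    rw [compatible_append, eq_iff_iff]
    constructor
    · rintro ⟨u, v, rfl, h1, h2⟩
      rw [← h1.length]
      simpa using ⟨h1, h2⟩
    · rintro ⟨h1, h2⟩
      exact ⟨_, _, (List.take_append_drop _ _).symm, h1, h2⟩
  · simp only [mul_add, map_add, Submodule.coe_add, Pi.add_apply, ha, hb]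
  · simp only [mul_smul_comm, map_smul, Submodule.coe_smul, Pi.smul_apply, ha, smul_eq_mul]
    ring

theorem realize_mul_E (A : ForestLikeAlphabet S) (g : List (NTerm ar)) (w : List A.Letter)
    (x : NatFree ar K) : (realize ar K A (x * E K g)).1 w =
      (realize ar K A x).1 (w.take (w.length - forestDeg g)) *
        (realize ar K A (E K g)).1 (w.drop (w.length - forestDeg g)) := by
  revert x
  refine word_induction (fun f => ?_) (fun a b ha hb => ?_) (fun c a ha => ?_)
  · rw [← E_append, realize_E, realize_E, realize_E, ite_mul, one_mul, zero_mul, ← ite_and]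
    congr 1
    rw [compatible_append, eq_iff_iff]
    constructor
    · rintro ⟨u, v, rfl, h1, h2⟩
      rw [← h2.length, List.length_append, Nat.add_sub_cancel]
      simpa using ⟨h1, h2⟩
    · rintro ⟨h1, h2⟩
      exact ⟨_, _, (List.take_append_drop _ _).symm, h1, h2⟩
  · simp only [add_mul, map_add, Submodule.coe_add, Pi.add_apply, ha, hb]
  · simp only [smul_mul_assoc, map_smul, Submodule.coe_smul, Pi.smul_apply, ha, smul_eq_mul]
    ring

variable (ar) in
/-- The kernel of the realizing map, as an ideal. -/
noncomputable def kerRealize (A : ForestLikeAlphabet S) : Ideal (NatFree ar K) where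
  carrier := {x | realize ar K A x = 0}
  add_mem' {x y} hx hy := by
    change realize ar K A x = 0 at hx
    change realize ar K A y = 0 at hy
    change realize ar K A (x + y) = 0
    rw [map_add, hx, hy, add_zero]
  zero_mem' := map_zero (realize ar K A)
  smul_mem' c x hx := by
    change realize ar K A x = 0 at hx
    change realize ar K A (c * x) = 0
    revert c
    refine word_induction (fun f => ?_) (fun a b ha hb => ?_) (fun c a ha => ?_)
    · refine Subtype.ext (funext fun w => ?_)
      rw [realize_E_mul, hx]
      exact mul_zero _
    · rw [add_mul, map_add, ha, hb, add_zero]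
    · rw [smul_mul_assoc, map_smul, ha, smul_zero]

instance (A : ForestLikeAlphabet S) : (kerRealize ar K A).IsTwoSided where
  mul_mem_of_left {x} c hx := by
    change realize ar K A x = 0 at hx
    change realize ar K A (x * c) = 0
    revert c
    refine word_induction (fun f => ?_) (fun a b ha hb => ?_) (fun c a ha => ?_)
    · refine Subtype.ext (funext fun w => ?_)
      rw [realize_mul_E, hx]
      exact zero_mul _
    · rw [mul_add, map_add, ha, hb, add_zero]
    · rw [mul_smul_comm, map_smul, ha, smul_zero]

end Realization

end NaturalHopf

open NaturalHopf

namespace NaturalHopf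

section Trimming
variable {S : Type*} {ar : S → ℕ}

/-! ### The alphabet of lengths -/

namespace ForestLikeAlphabet

/-- The decoration of a letter of the alphabet of lengths. -/
def symbol : (lengths S).Letter → S :=
  Quotient.lift (fun a : S × List ℕ => a.1) fun a b
    (h : (a.1, a.2.length) = (b.1, b.2.length)) => (Prod.mk.inj h).1

/-- The length of a letter of the alphabet of lengths. -/
def length : (lengths S).Letter → ℕ :=
  Quotient.lift (fun a : S × List ℕ => a.2.length) fun a b
    (h : (a.1, a.2.length) = (b.1, b.2.length)) => (Prod.mk.inj h).2

/-- The letter of the alphabet of lengths with given decoration and length. -/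
def letter (a : S × ℕ) : (lengths S).Letter :=
  Quotient.mk _ (a.1, List.replicate a.2 0)

@[simp] theorem symbol_letter (a : S × ℕ) : symbol (letter a) = a.1 := rfl

@[simp] theorem length_letter (a : S × ℕ) : length (letter a) = a.2 := List.length_replicate

theorem mk_eq_letter (a : S × List ℕ) :
    (Quotient.mk _ a : (lengths S).Letter) = letter (a.1, a.2.length) :=
  Quotient.sound (Prod.ext rfl List.length_replicate.symm)

theorem letter_symbol_length (x : (lengths S).Letter) : letter (symbol x, length x) = x := by
  obtain ⟨a, rfl⟩ := Quotient.exists_rep x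
  exact (mk_eq_letter a).symm

/-- The word `0^ℓ` represents every letter of length `ℓ`, so the root condition is vacuous on this
alphabet. -/
theorem mem_root_lengths (x : (lengths S).Letter) : x ∈ (lengths S).root :=
  ⟨(symbol x, List.replicate (length x) 0), ⟨_, rfl⟩, letter_symbol_length x⟩

theorem mem_deco_lengths {s : S} {x : (lengths S).Letter} :
    x ∈ (lengths S).deco s ↔ symbol x = s := by
  constructor
  · rintro ⟨a, h, rfl⟩
    exact h
  · rintro rfl
    exact ⟨(symbol x, List.replicate (length x) 0), rfl, letter_symbol_length x⟩

/-- The index `j` disappears from the right-hand side: this is where the position of a child among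
its siblings is forgotten, leaving only the order on lengths. -/
theorem edge_lengths {j : ℕ+} {x y : (lengths S).Letter} :
    (lengths S).edge j x y ↔ length x < length y := by
  constructor
  · rintro ⟨a, b, ⟨l, h⟩, rfl, rfl⟩
    change a.2.length < b.2.length
    rw [h]
    simp only [List.length_append, List.length_singleton, List.length_replicate]
    omega
  · intro h
    -- Representatives `0^p` and `0^p j 0^(q-p-1)`, where `p < q` are the two lengths; the second
    -- word has length `q`.
    refine ⟨(symbol x, List.replicate (length x) 0), (symbol y, List.replicate (length x) 0 ++
      [(j : ℕ)] ++ List.replicate (length y - length x - 1) 0), ⟨_, rfl⟩,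
      letter_symbol_length x, ?_⟩
    refine (mk_eq_letter _).trans (Eq.trans (congrArg letter ?_) (letter_symbol_length y))
    refine Prod.ext rfl ?_
    simp only [List.length_append, List.length_singleton, List.length_replicate]
    omega

end ForestLikeAlphabet

open ForestLikeAlphabet

/-! ### Compatible words depend only on the trimmed forest -/

theorem Language.mem_prod_ofFn {α : Type*} {n : ℕ} (L : Fin n → Language α) (v : List α) :
    v ∈ (List.ofFn L).prod ↔ ∃ ws : Fin n → List α, v = (List.ofFn ws).flatten ∧
      ∀ i, ws i ∈ L i := by
  induction n generalizing v with
  | zero =>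
    simp only [List.ofFn_zero, List.prod_nil, Language.mem_one, List.flatten_nil]
    exact ⟨fun h => ⟨Fin.elim0, h, fun i => i.elim0⟩, fun ⟨_, h, _⟩ => h⟩
  | succ n ih =>
    rw [List.ofFn_succ, List.prod_cons, Language.mem_mul]
    constructor
    · rintro ⟨a, ha, b, hb, rfl⟩
      obtain ⟨ws, rfl, h⟩ := (ih _ _).1 hb
      refine ⟨Fin.cons a ws, by simp [List.ofFn_succ], fun i => ?_⟩
      cases i using Fin.cases
      · exact ha
      · exact h _
    · rintro ⟨ws, rfl, h⟩
      exact ⟨ws 0, h 0, _, (ih _ _).2 ⟨fun i => ws i.succ, rfl, fun i => h _⟩,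
        by simp [List.ofFn_succ]⟩

/-- Erasing the absent entries does not change an ordered product in which they count as `1`. For
languages, `1` contains only the empty word, which is the contribution of a leaf; this is what makes
trimming harmless. -/
theorem prod_map_reduceOption_ofFn {X M : Type*} [Monoid M] (F : X → M) {n : ℕ}
    (us : Fin n → Option X) :
    ((List.ofFn us).reduceOption.map F).prod =
      (List.ofFn fun i => (us i).elim 1 F).prod := by
  induction n with
  | zero => rfl
  | succ n ih =>
    rw [List.ofFn_succ, List.ofFn_succ, List.prod_cons, ← ih]
    cases us 0 <;> simp

namespace TrimTree

/-- The words that label a trimmed tree with letters of the alphabet of lengths, where the letter of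
the root has length at least `m` and the lengths increase along the edges. -/
def labelings : TrimTree ar → ℕ → Language (lengths S).Letter
  | node s _ _ ts, m => {w | ∃ x v, w = x :: v ∧ symbol x = s ∧ m ≤ length x ∧
      v ∈ (List.ofFn fun i => (ts i).labelings (length x + 1)).prod}

theorem mem_labelings_node {s : S} {k : ℕ} {hk : k ≤ ar s} {ts : Fin k → TrimTree ar} {m : ℕ}
    {w : List (lengths S).Letter} :
    w ∈ (node s k hk ts).labelings m ↔ ∃ x v, w = x :: v ∧ symbol x = s ∧ m ≤ length x ∧
      v ∈ (List.ofFn fun i => (ts i).labelings (length x + 1)).prod :=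
  Iff.rfl

theorem mem_labelings_graftRoot {s : S} {f : List (TrimTree ar)} {hf : f.length ≤ ar s} {m : ℕ}
    {w : List (lengths S).Letter} :
    w ∈ (graftRoot s f hf).labelings m ↔ ∃ x v, w = x :: v ∧ symbol x = s ∧ m ≤ length x ∧
      v ∈ (f.map fun t => t.labelings (length x + 1)).prod := by
  rw [graftRoot, mem_labelings_node]
  refine exists_congr fun x => exists_congr fun v => ?_
  have := List.map_ofFn (f := f.get) (g := fun t : TrimTree ar => t.labelings (length x + 1))
  rw [List.ofFn_get] at this
  rw [this]
  rfl

end TrimTree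

namespace STerm

/-- The words that label a term with letters of the alphabet of lengths, where the letter of
the root has length at least `m` and the lengths increase along the edges. -/
def IsLabeling (t : STerm ar) (m : ℕ) (w : List (lengths S).Letter) : Prop :=
  ∃ a : Node t → (lengths S).Letter, t.preorder a = w ∧
    (∀ x, x.IsRoot → m ≤ length (a x)) ∧ (∀ x, symbol (a x) = x.deco) ∧
    ∀ (j : ℕ+) (x y : Node t), Edge j t x y → length (a x) < length (a y)

theorem isLabeling_leaf {m : ℕ} {w : List (lengths S).Letter} :
    (leaf : STerm ar).IsLabeling m w ↔ w = [] := by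
  constructor
  · rintro ⟨a, rfl, -⟩
    rfl
  · rintro rfl
    exact ⟨(fun x => nomatch x), rfl, (fun x => nomatch x), (fun x => nomatch x),
      fun _ x => nomatch x⟩

/-- The strict inequality along the edges leaving the root becomes the lower bound `length x + 1` on
the roots of the children. Carrying such a bound is what lets the labelings of the children be
chosen independently of each other. -/
theorem isLabeling_node {s : S} {ts : Fin (ar s) → STerm ar} {m : ℕ}
    {w : List (lengths S).Letter} :
    (node s ts).IsLabeling m w ↔ ∃ x ws, w = x :: (List.ofFn ws).flatten ∧ symbol x = s ∧
      m ≤ length x ∧ ∀ i, (ts i).IsLabeling (length x + 1) (ws i) := by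
  constructor
  · rintro ⟨a, rfl, h1, h2, h3⟩
    refine ⟨a (.root s ts), _, rfl, h2 _, h1 _ trivial, fun i =>
      ⟨fun x => a (.child s ts i x), rfl, fun x hx => ?_, fun x => h2 _, fun j x y h =>
        h3 j _ _ (.child _ _ _ _ _ h)⟩⟩
    -- Edges are numbered from `1` and children from `0`, hence the shift.
    exact h3 ⟨i + 1, Nat.succ_pos _⟩ _ _ (.root s ts i rfl x hx)
  · rintro ⟨x, ws, rfl, h1, h2, h3⟩
    choose b hb1 hb2 hb3 hb4 using h3
    refine ⟨fun | .root _ _ => x | .child _ _ i y => b i y, ?_, ?_, ?_, ?_⟩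
    · simp only [preorder, hb1]
    · rintro (_ | ⟨_, _, i, y⟩) hy
      · exact h2
      · exact hy.elim
    · rintro (_ | ⟨_, _, i, y⟩)
      · exact h1
      · exact hb3 i y
    · rintro j _ _ (⟨_, _, i, hi, y, hy⟩ | ⟨_, _, i, y, z, h⟩)
      · exact hb2 i y hy
      · exact hb4 i j y z h

/-- Both sides obey the same recursion, once the children that are leaves are dropped from the
product by `prod_map_reduceOption_ofFn`. -/
theorem isLabeling_iff (t : STerm ar) (m : ℕ) (w : List (lengths S).Letter) :
    t.IsLabeling m w ↔ w ∈ t.tr.elim 1 fun u => u.labelings m := by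
  induction t generalizing m w with
  | leaf => exact isLabeling_leaf
  | node s ts ih =>
    rw [isLabeling_node]
    simp only [tr, Option.elim_some, TrimTree.mem_labelings_graftRoot, prod_map_reduceOption_ofFn,
      Language.mem_prod_ofFn, ← ih]
    constructor
    · rintro ⟨x, ws, rfl, h1, h2, h3⟩
      exact ⟨x, _, rfl, h1, h2, ws, rfl, h3⟩
    · rintro ⟨x, _, rfl, h1, h2, ws, rfl, h3⟩
      exact ⟨x, ws, rfl, h1, h2, h3⟩

end STerm

/-- The words that label a trimmed forest with letters of the alphabet of lengths, where the lengths
increase along the edges. -/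
def forestLabelings (f : List (TrimTree ar)) : Language (lengths S).Letter :=
  (f.map fun t => t.labelings 0).prod

/-- The bound `0` imposes nothing on the root, in agreement with `mem_root_lengths`. -/
theorem compatible_singleton {t : NTerm ar} {w : List (lengths S).Letter} :
    Compatible (lengths S) [t] w ↔ t.1.IsLabeling 0 w := by
  constructor
  · rintro ⟨a, rfl, -, h2, h3⟩
    exact ⟨fun x => a (.here x), by simp [preorderForest], fun _ _ => Nat.zero_le _,
      fun x => mem_deco_lengths.1 (h2 (.here x)),
      fun j x y h => edge_lengths.1 (h3 j _ _ (.here h))⟩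
  · rintro ⟨a, rfl, -, h2, h3⟩
    refine ⟨fun | .here x => a x, by simp [preorderForest], fun _ _ => mem_root_lengths _,
      ?_, ?_⟩
    · rintro (x | x)
      · exact mem_deco_lengths.2 (h2 x)
      · cases x
    · rintro j _ _ (h | h)
      · exact edge_lengths.2 (h3 j _ _ h)
      · cases h

theorem tr_nil : tr ([] : List (NTerm ar)) = [] := rfl

theorem tr_append (f g : List (NTerm ar)) : tr (f ++ g) = tr f ++ tr g := List.filterMap_append

theorem tr_singleton (t : NTerm ar) : tr [t] = t.1.tr.toList := by
  rw [tr, List.filterMap_cons]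
  cases t.1.tr <;> rfl

/-- The right-hand side sees only `tr f`; this gives the factorization of the realizing map through
trimming. Trees of a forest are labeled independently, so the claim reduces to single terms. -/
theorem compatible_lengths_iff {f : List (NTerm ar)} {w : List (lengths S).Letter} :
    Compatible (lengths S) f w ↔ w ∈ forestLabelings (tr f) := by
  induction f generalizing w with
  | nil => exact compatible_nil
  | cons t f ih =>
    have h1 : forestLabelings (tr (t :: f)) =
        (t.1.tr.elim 1 fun u => u.labelings 0) * forestLabelings (tr f) := by
      rw [← List.singleton_append, tr_append, tr_singleton]
      cases t.1.tr <;> simp [forestLabelings]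
    rw [compatible_cons, h1, Language.mem_mul]
    simp only [compatible_singleton, STerm.isLabeling_iff, ih]
    constructor
    · rintro ⟨u, v, rfl, h, h'⟩
      exact ⟨u, h, v, h', rfl⟩
    · rintro ⟨u, h, v, h', rfl⟩
      exact ⟨u, v, rfl, h, h'⟩

/-! ### The word of depths of a trimmed forest -/

namespace TrimTree

/-- The word of the pairs (decoration, depth) of the nodes of a tree in preorder, the root having
depth `m`. -/
def depths : TrimTree ar → ℕ → List (S × ℕ)
  | node s _ _ ts, m => (s, m) :: (List.ofFn fun i => (ts i).depths (m + 1)).flatten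

theorem depths_node_eq (s : S) (k : ℕ) (hk : k ≤ ar s) (ts : Fin k → TrimTree ar) (m : ℕ) :
    (node s k hk ts).depths m =
      (s, m) :: ((List.ofFn ts).map fun t => t.depths (m + 1)).flatten := by
  rw [depths, List.map_ofFn]
  rfl

/-- Depths grow by exactly one along each edge, so every lower bound on lengths is attained. -/
theorem map_depths_mem_labelings (t : TrimTree ar) (m : ℕ) :
    (t.depths m).map letter ∈ t.labelings m := by
  induction t generalizing m with
  | node s k hk ts ih =>
    refine mem_labelings_node.2 ⟨letter (s, m), _, List.map_cons .., rfl, by simp, ?_⟩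
    refine (Language.mem_prod_ofFn _ _).2
      ⟨fun i => ((ts i).depths (m + 1)).map letter, ?_, fun i => ?_⟩
    · rw [List.map_flatten, List.map_ofFn]
      rfl
    · simpa using ih i (m + 1)

end TrimTree

theorem forall₂_flatten_ofFn {α β : Type*} {R : α → β → Prop} {n : ℕ} {us : Fin n → List α}
    {vs : Fin n → List β} (h : ∀ i, List.Forall₂ R (us i) (vs i)) :
    List.Forall₂ R (List.ofFn us).flatten (List.ofFn vs).flatten := by
  induction n with
  | zero => simp
  | succ n ih =>
    rw [List.ofFn_succ, List.ofFn_succ, List.flatten_cons, List.flatten_cons]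
    exact List.rel_append (h 0) (ih fun i => h i.succ)

/-- Depths form the pointwise smallest labeling. Two bounds `m ≤ m'` are needed for the induction:
the root may receive a letter longer than its depth, which raises the bound on the children while
their depths stay the same. -/
theorem TrimTree.forall₂_of_mem_labelings {t : TrimTree ar} {m m' : ℕ} (hm : m ≤ m')
    {w : List (lengths S).Letter} (hw : w ∈ t.labelings m') :
    List.Forall₂ (fun a x => a.1 = symbol x ∧ a.2 ≤ length x) (t.depths m) w := by
  induction t generalizing m m' w with
  | node s k hk ts ih =>
    obtain ⟨x, v, rfl, rfl, h2, h3⟩ := mem_labelings_node.1 hw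
    obtain ⟨ws, rfl, h4⟩ := (Language.mem_prod_ofFn _ _).1 h3
    exact .cons ⟨rfl, hm.trans h2⟩ (forall₂_flatten_ofFn fun i => ih i (by omega) (h4 i))

/-- The word of the pairs (decoration, depth) of the nodes of a forest in preorder. -/
def forestDepths (f : List (TrimTree ar)) (m : ℕ) : List (S × ℕ) :=
  (f.map fun t => t.depths m).flatten

theorem map_forestDepths_mem (f : List (TrimTree ar)) :
    (forestDepths f 0).map letter ∈ forestLabelings f := by
  induction f with
  | nil => rfl
  | cons t f ih =>
    simp only [forestDepths, forestLabelings, List.map_cons, List.flatten_cons, List.map_append,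
      List.prod_cons]
    exact Language.append_mem_mul (t.map_depths_mem_labelings 0) ih

theorem forall₂_of_mem_forestLabelings {f : List (TrimTree ar)} {w : List (lengths S).Letter}
    (hw : w ∈ forestLabelings f) :
    List.Forall₂ (fun a x => a.1 = symbol x ∧ a.2 ≤ length x) (forestDepths f 0) w := by
  induction f generalizing w with
  | nil =>
    obtain rfl : w = [] := hw
    exact .nil
  | cons t f ih =>
    rw [forestLabelings, List.map_cons, List.prod_cons, Language.mem_mul] at hw
    obtain ⟨u, hu, v, hv, rfl⟩ := hw
    exact List.rel_append (TrimTree.forall₂_of_mem_labelings le_rfl hu) (ih hv)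

/-- Unique decoding of a preorder word of depths. The roots of the forest sit at depth `m`, so a
remainder starting strictly below `m` marks where the forest ends. The remainders `u` and `v` are
there for the induction: after the first root, the word splits into its children, at depth `m + 1`,
followed by the rest of the forest, which serves as their remainder. -/
theorem forestDepths_append_inj {f g : List (TrimTree ar)} {m : ℕ} {u v : List (S × ℕ)}
    (hu : ∀ a ∈ u.head?, a.2 < m) (hv : ∀ a ∈ v.head?, a.2 < m)
    (h : forestDepths f m ++ u = forestDepths g m ++ v) : f = g ∧ u = v := by
  -- Induction on the number of nodes, since the recursion goes both to the children of the first
  -- root and to the remaining trees.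
  obtain ⟨n, hn⟩ : ∃ n, (forestDepths f m).length ≤ n := ⟨_, le_rfl⟩
  induction n generalizing f g m u v with
  | zero =>
    match f, g with
    | [], [] => exact ⟨rfl, h⟩
    | [], .node s k hk ts :: g =>
      obtain rfl : u = (s, m) :: _ := h
      exact (lt_irrefl m (hu (s, m) rfl)).elim
    | .node s k hk ts :: f, _ => simp [forestDepths, TrimTree.depths] at hn
  | succ n ih =>
    match f, g with
    | [], [] => exact ⟨rfl, h⟩
    | [], .node s k hk ts :: g =>
      obtain rfl : u = (s, m) :: _ := h
      exact (lt_irrefl m (hu (s, m) rfl)).elim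
    | .node s k hk ts :: f, [] =>
      obtain rfl : (s, m) :: _ = v := h
      exact (lt_irrefl m (hv (s, m) rfl)).elim
    | .node s k hk ts :: f, .node s' k' hk' ts' :: g =>
      have e : ∀ (s : S) (k : ℕ) (hk : k ≤ ar s) (ts : Fin k → TrimTree ar)
          (f : List (TrimTree ar)), forestDepths (.node s k hk ts :: f) m =
            (s, m) :: (forestDepths (List.ofFn ts) (m + 1) ++ forestDepths f m) := by
        intro s k hk ts f
        rw [forestDepths, List.map_cons, List.flatten_cons, TrimTree.depths_node_eq]
        rfl
      -- What follows the children begins either with the next root, at depth `m`, or with the head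
      -- of `u`; both lie below `m + 1`.
      have hd : ∀ (f : List (TrimTree ar)) (u : List (S × ℕ)), (∀ a ∈ u.head?, a.2 < m) →
          ∀ a ∈ (forestDepths f m ++ u).head?, a.2 < m + 1 := by
        intro f u hu a ha
        match f with
        | [] => exact (hu a ha).trans (Nat.lt_succ_self m)
        | .node s k hk ts :: f =>
          obtain rfl : (s, m) = a := by simpa [e] using ha
          exact Nat.lt_succ_self m
      rw [e] at hn
      simp only [List.length_cons, List.length_append] at hn
      rw [e, e, List.cons_append, List.cons_append, List.append_assoc, List.append_assoc,
        List.cons.injEq] at h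
      obtain ⟨h1, h2⟩ := h
      obtain rfl : s = s' := congrArg Prod.fst h1
      obtain ⟨h3, h4⟩ := ih (hd f u hu) (hd g v hv) h2 (by omega)
      obtain ⟨rfl, rfl⟩ := ih hu hv h4 (by omega)
      -- The number of children is read off the length of the decoded list.
      obtain rfl : k = k' := by simpa using congrArg List.length h3
      obtain rfl := List.ofFn_injective h3
      exact ⟨rfl, rfl⟩

theorem forestDepths_injective (m : ℕ) :
    Function.Injective fun f : List (TrimTree ar) => forestDepths f m := fun f g h =>
  (forestDepths_append_inj (f := f) (g := g) (m := m) (u := []) (v := []) (by simp) (by simp)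
    (by simpa using h)).1

/-- A termwise inequality between words forces `∑ u ≤ ∑ v`, so the reverse inequality of sums leaves
no slack in any entry. -/
theorem eq_of_forall₂_of_sum_le {u v : List (S × ℕ)}
    (h : List.Forall₂ (fun a b => a.1 = b.1 ∧ a.2 ≤ b.2) u v)
    (hs : (v.map Prod.snd).sum ≤ (u.map Prod.snd).sum) : u = v := by
  have key : ∀ {u v : List (S × ℕ)},
      List.Forall₂ (fun a b => a.1 = b.1 ∧ a.2 ≤ b.2) u v →
        (u.map Prod.snd).sum ≤ (v.map Prod.snd).sum := by
    intro u v h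
    induction h with
    | nil => exact le_rfl
    | cons h _ ih =>
      simp only [List.map_cons, List.sum_cons]
      exact add_le_add h.2 ih
  induction h with
  | nil => rfl
  | cons h h' ih =>
    have := key h'
    simp only [List.map_cons, List.sum_cons] at hs
    have := h.2
    rw [ih (by omega)]
    congr 1
    exact Prod.ext h.1 (by omega)

/-- The sum of the depths of the nodes of a forest. -/
def totalDepth (f : List (TrimTree ar)) : ℕ := ((forestDepths f 0).map Prod.snd).sum

/-- Triangularity: if `f` admits the depth word of `g`, minimality of depths bounds each depth in
`f` by the one in `g`, and the comparison of total depths turns this into an equality. -/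
theorem eq_of_map_forestDepths_mem {f g : List (TrimTree ar)}
    (h : (forestDepths g 0).map letter ∈ forestLabelings f)
    (hs : totalDepth g ≤ totalDepth f) : f = g := by
  refine forestDepths_injective 0 (eq_of_forall₂_of_sum_le ?_ hs)
  have := forall₂_of_mem_forestLabelings h
  rw [List.forall₂_map_right_iff] at this
  simpa using this

end Trimming
end NaturalHopf
namespace NaturalHopf

/-! ### Compatibility of bialgebra morphisms with antipodes -/

section BialgHom
variable {K A B : Type*} [Field K] [Ring A] [Ring B] [HopfAlgebra K A] [HopfAlgebra K B]
open WithConv HopfAlgebra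

/-- In the convolution algebra of linear maps from `A` to `B`, the antipode of `B` after `f` is a
left inverse of `f`, because `f` respects the coproduct, and `f` after the antipode of `A` is a
right inverse, because `f` respects the product. The two inverses coincide. -/
theorem bialgHom_antipode (f : A →ₐc[K] B) (x : A) : f (antipode K x) = antipode K (f x) := by
  let F : WithConv (A →ₗ[K] B) := toConv f.toCoalgHom.toLinearMap
  let L : WithConv (A →ₗ[K] B) := toConv (antipode K ∘ₗ f.toCoalgHom.toLinearMap)
  let R : WithConv (A →ₗ[K] B) := toConv (f.toCoalgHom.toLinearMap ∘ₗ antipode K)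
  have hL : L * F = 1 := by
    apply ofConv_injective
    calc (L * F).ofConv
        = (toConv (antipode K) * toConv .id : WithConv (B →ₗ[K] B)).ofConv ∘ₗ
            f.toCoalgHom.toLinearMap := by
          rw [LinearMap.convMul_comp_coalgHom_distrib]; rfl
      _ = _ := by rw [LinearMap.antipode_mul_id, LinearMap.convOne_comp_coalgHom]
  have hR : F * R = 1 := by
    apply ofConv_injective
    calc (F * R).ofConv
        = (AlgHomClass.toAlgHom f).toLinearMap ∘ₗ
            (toConv .id * toConv (antipode K) : WithConv (A →ₗ[K] A)).ofConv := by
          rw [LinearMap.algHom_comp_convMul_distrib]; rfl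
      _ = _ := by rw [LinearMap.id_mul_antipode, LinearMap.algHom_comp_convOne]
  exact congrArg (fun g : WithConv (A →ₗ[K] B) => g.ofConv x) (left_inv_eq_right_inv hL hR).symm

end BialgHom

section TrimMap
variable {S : Type*} {ar : S → ℕ}

/-! ### Trimming is a morphism of Hopf algebras -/

/-- Naturality of `cutSeq`. The lower parts are concatenated, hence the requirement that `G` be a
monoid morphism. -/
theorem cutSeq_map {T T' X X' : Type*} (F : T → T') (G : List X → List X') (h0 : G [] = [])
    (h1 : ∀ u v, G (u ++ v) = G u ++ G v) {n : ℕ} (m : Fin n → Multiset (T × List X)) :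
    (cutSeq n m).map (fun p => (fun i => F (p.1 i), G p.2)) =
      cutSeq n fun i => (m i).map fun p => (F p.1, G p.2) := by
  induction n with
  | zero =>
    simp only [cutSeq, Multiset.map_singleton, h0]
    congr 2
    exact funext fun i => i.elim0
  | succ n ih =>
    simp only [cutSeq, ← ih, Multiset.map_bind, Multiset.map_map, Multiset.bind_map,
      Function.comp_def, h1]
    refine Multiset.bind_congr fun p _ => Multiset.map_congr rfl fun q _ => ?_
    congr 1
    funext i
    cases i using Fin.cases <;> rfl

theorem tr_rd_singleton (t : STerm ar) : tr (rd [t]) = t.tr.toList := by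
  cases t with
  | leaf => rw [rd_leaf]; rfl
  | node s ts => rw [rd_node, tr_singleton]

/-- Combinatorial core of the compatibility with coproducts, with multiplicities since both sides
are multisets: the cuts of a term match those of its trimmed tree. Each family consists of the cut
above the root, together with the choices of one cut in each child; a leaf child has a single cut,
as has the empty tree. -/
theorem termCuts_map_tr (t : STerm ar) :
    (termCuts t).map (fun p => (p.1.tr, tr p.2)) = TrimTree.optCuts t.tr := by
  induction t with
  | leaf => simp [termCuts_leaf, STerm.tr, TrimTree.optCuts, tr_nil]
  | node s ts ih =>
    rw [termCuts_node, STerm.tr, TrimTree.optCuts_node s le_rfl, Multiset.map_cons, Multiset.map_map]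
    congr 1
    simp only [← ih]
    rw [← cutSeq_map STerm.tr tr tr_nil tr_append, Multiset.map_map]
    rfl

/-- A node decorated by `s` has at most `ar s` children, so there is room to complete them with
leaves. -/
theorem tr_surjective : Function.Surjective (tr : List (NTerm ar) → List (TrimTree ar)) := by
  have key : ∀ u : TrimTree ar, ∃ t : STerm ar, t.tr = some u := by
    intro u
    induction u with
    | node s k hk ts ih =>
      choose b hb using ih
      -- The children occupy the first `k` positions and leaves fill the others; any
      -- order-preserving placement would do.
      refine ⟨.node s fun i => if h : (i : ℕ) < k then b ⟨i, h⟩ else .leaf, ?_⟩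
      rw [STerm.tr]
      congr 1
      refine TrimTree.graftRoot_ofFn _ _ _ _ _ _ ?_
      have e : (fun i : Fin (ar s) =>
          (if h : (i : ℕ) < k then b ⟨i, h⟩ else (.leaf : STerm ar)).tr) =
          fun i : Fin (ar s) => if h : (i : ℕ) < k then some (ts ⟨i, h⟩) else none := by
        funext i
        split_ifs
        · exact hb _
        · rfl
      rw [e]
      -- With the arity replaced by a variable, it can be written `k + d`, which separates the `k`
      -- children from the `d` added leaves.
      generalize ar s = n at hk
      obtain ⟨d, rfl⟩ := Nat.exists_eq_add_of_le hk
      rw [List.ofFn_add, List.reduceOption_append]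
      have e1 : (List.ofFn fun i : Fin d => if h : ((Fin.natAdd k i : Fin (k + d)) : ℕ) < k then
          some (ts ⟨_, h⟩) else none).reduceOption = [] := by
        simp [List.reduceOption]
      rw [e1, List.append_nil]
      simpa using TrimTree.reduceOption_ofFn_some ts
  intro f
  induction f with
  | nil => exact ⟨[], rfl⟩
  | cons u f ih =>
    obtain ⟨t, ht⟩ := key u
    obtain ⟨g, rfl⟩ := ih
    have h : t ≠ .leaf := by
      rintro rfl
      cases ht
    exact ⟨⟨t, h⟩ :: g, by simp [tr, ht]⟩

variable (K : Type*) [Field K]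

variable (ar) in
/-- The algebra morphism sending `E_f` to `E_{tr f}`. -/
noncomputable def trimAlgHom : NatFree ar K →ₐ[K] NCK ar K := liftWord fun t => E K (tr [t])

theorem trimAlgHom_E (f : List (NTerm ar)) : trimAlgHom ar K (E K f) = E K (tr f) := by
  rw [trimAlgHom, liftWord_E]
  induction f with
  | nil => exact (E_nil (K := K)).symm
  | cons t f ih =>
    rw [List.map_cons, List.prod_cons, ih, ← E_append, ← tr_append, List.singleton_append]

/-- One generator at a time is enough, both sides being values of algebra morphisms; there the two
coproducts are sums over the cuts matched by `termCuts_map_tr`. -/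
theorem comul_trimAlgHom (t : NTerm ar) :
    Coalgebra.comul (R := K) (trimAlgHom ar K (E K [t])) =
      TensorProduct.map (trimAlgHom ar K).toLinearMap (trimAlgHom ar K).toLinearMap
        (Coalgebra.comul (R := K) (E K [t])) := by
  have h := (TrimTree.trimSystem ar).cutWord_toWord t.1.tr
  change cutWord _ t.1.tr.toList = (TrimTree.optCuts t.1.tr).map _ at h
  rw [trimAlgHom_E, comul_nck, comul_natFree, natCoprod_E, nckCoprod_E, cutWord_singleton,
    tr_singleton, h, ← termCuts_map_tr]
  simp only [sumE, map_multiset_sum', Multiset.map_map, Function.comp_def,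
    CutSystem.letterCuts]
  congr 1
  refine Multiset.map_congr rfl fun p _ => ?_
  simp only [TensorProduct.map_tmul, AlgHom.toLinearMap_apply, trimAlgHom_E]
  congr 2
  exact (tr_rd_singleton p.1).symm

theorem counit_E (f : List (NTerm ar)) :
    Coalgebra.counit (R := K) (E K f : NatFree ar K) = if f = [] then 1 else 0 :=
  counitWord_E f

theorem counit_nck_E (f : List (TrimTree ar)) :
    Coalgebra.counit (R := K) (E K f : NCK ar K) = if f = [] then 1 else 0 :=
  counitWord_E f

/-- Needed for the counit: trimming never turns a nonempty reduced forest into the empty one, as the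
root of each term survives. -/
theorem tr_singleton_ne_nil (t : NTerm ar) : tr [t] ≠ [] := by
  obtain ⟨t, ht⟩ := t
  cases t with
  | leaf => exact (ht rfl).elim
  | node s ts => simp [tr_singleton, STerm.tr]

variable (ar) in
/-- The morphism of bialgebras sending `E_f` to `E_{tr f}`. -/
noncomputable def trimMap : NatFree ar K →ₐc[K] NCK ar K :=
  .ofAlgHom (trimAlgHom ar K)
    (by
      apply algHom_ext_word
      intro t
      refine Eq.trans (congrArg (Coalgebra.counit (R := K)) (trimAlgHom_E K [t])) ?_
      refine (counit_nck_E K _).trans (Eq.trans ?_ (counit_E K _).symm)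
      rw [if_neg (tr_singleton_ne_nil t), if_neg (List.cons_ne_nil _ _)])
    (algHom_ext_word fun t => (comul_trimAlgHom K t).symm)

theorem trimMap_E (f : List (NTerm ar)) : trimMap ar K (E K f) = E K (tr f) := trimAlgHom_E K f

/-! ### A linear section of trimming, and the kernel of trimming -/

variable (ar) in
/-- A linear section of the trimming map. -/
noncomputable def trimSection : NCK ar K →ₗ[K] NatFree ar K :=
  (eBasis K (TrimTree ar)).constr K fun f => E K (Function.surjInv tr_surjective f)

theorem trimSection_E (f : List (TrimTree ar)) :
    trimSection ar K (E K f) = E K (Function.surjInv tr_surjective f) := by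
  rw [trimSection, ← eBasis_apply, Module.Basis.constr_basis]

theorem trimMap_trimSection (x : NCK ar K) : trimMap ar K (trimSection ar K x) = x := by
  revert x
  refine word_induction (fun f => ?_) (fun a b ha hb => ?_) (fun c a ha => ?_)
  · rw [trimSection_E, trimMap_E, Function.surjInv_eq tr_surjective]
  · rw [map_add, map_add, ha, hb]
  · rw [map_smul, map_smul, ha]

/-- On a basis element this is the difference between `E_f` and the chosen representative of the
forests with the same trimming, hence a generator of the span. If trimming kills `x`, the subtracted
term vanishes. -/
theorem sub_trimSection_mem (x : NatFree ar K) :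
    x - trimSection ar K (trimMap ar K x) ∈ Submodule.span K
      {x | ∃ f₁ f₂ : List (NTerm ar), tr f₁ = tr f₂ ∧ x = E K f₁ - E K f₂} := by
  revert x
  refine word_induction (fun f => ?_) (fun a b ha hb => ?_) (fun c a ha => ?_)
  · rw [trimMap_E, trimSection_E]
    exact Submodule.subset_span ⟨f, _, (Function.surjInv_eq tr_surjective _).symm, rfl⟩
  · rw [map_add, map_add, add_sub_add_comm]
    exact Submodule.add_mem _ ha hb
  · rw [map_smul, map_smul, ← smul_sub]
    exact Submodule.smul_mem _ _ ha

theorem trimMap_eq_zero_iff (x : NatFree ar K) : trimMap ar K x = 0 ↔ x ∈ Submodule.span K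
      {x | ∃ f₁ f₂ : List (NTerm ar), tr f₁ = tr f₂ ∧ x = E K f₁ - E K f₂} := by
  constructor
  · intro h
    have := sub_trimSection_mem K x
    rwa [h, map_zero, sub_zero] at this
  · intro h
    refine Submodule.span_induction ?_ (map_zero _) (fun x y _ _ hx hy => ?_)
      (fun a x _ hx => ?_) h
    · rintro _ ⟨f₁, f₂, h, rfl⟩
      rw [map_sub, trimMap_E, trimMap_E, h, sub_self]
    · rw [map_add, hx, hy, add_zero]
    · rw [map_smul, hx, smul_zero]

/-! ### The kernel of the realizing map on the alphabet of lengths -/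

open ForestLikeAlphabet

open Classical in
variable (ar) in
/-- The linear map sending `E_f` to the sum of the labelings of the trimmed forest `f`. -/
noncomputable def realizeTrim : NCK ar K →ₗ[K] (List (lengths S).Letter → K) :=
  (eBasis K (TrimTree ar)).constr K fun f w => if w ∈ forestLabelings f then 1 else 0

/-- The realizing map factors through trimming: on basis elements this is `compatible_lengths_iff`.
-/
theorem realizeTrim_trimMap (x : NatFree ar K) :
    realizeTrim ar K (trimMap ar K x) = (realize ar K (lengths S) x).1 := by
  revert x
  refine word_induction (fun f => ?_) (fun a b ha hb => ?_) (fun c a ha => ?_)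
  · funext w
    rw [trimMap_E, realize_E, realizeTrim, ← eBasis_apply, Module.Basis.constr_basis]
    by_cases h : Compatible (lengths S) f w
    · rw [if_pos h, if_pos (compatible_lengths_iff.1 h)]
    · rw [if_neg h, if_neg fun h' => h (compatible_lengths_iff.2 h')]
  · rw [map_add, map_add, map_add, ha, hb]
    rfl
  · rw [map_smul, map_smul, map_smul, ha]
    rfl

theorem realizeTrim_injective (y : NCK ar K) (h : realizeTrim ar K y = 0) : y = 0 := by
  classical
  rw [← (eBasis K (TrimTree ar)).repr.map_eq_zero_iff]
  set c := (eBasis K (TrimTree ar)).repr y with hc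
  by_contra h0
  -- Minimality of the total depth isolates `g`: evaluated at the depth word of `g`, the sum retains
  -- only the coefficient of `g`, which must then vanish.
  obtain ⟨g, hg, hmin⟩ := Finset.exists_min_image c.support totalDepth
    (Finsupp.support_nonempty_iff.2 h0)
  refine (Finsupp.mem_support_iff.1 hg) ?_
  have := congrFun h ((forestDepths g 0).map letter)
  rw [realizeTrim, Module.Basis.constr_apply, ← hc, Finsupp.sum, Finset.sum_apply,
    Finset.sum_eq_single g] at this
  · simpa [map_forestDepths_mem] using this
  · intro f hf hfg
    rw [Pi.smul_apply, if_neg, smul_zero]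
    exact fun hm => hfg (eq_of_map_forestDepths_mem hm (hmin f hf))
  · exact fun h => (h hg).elim

theorem realize_eq_zero_iff (x : NatFree ar K) :
    realize ar K (lengths S) x = 0 ↔ trimMap ar K x = 0 := by
  constructor
  · intro h
    apply realizeTrim_injective
    rw [realizeTrim_trimMap, h]
    rfl
  · intro h
    refine Subtype.ext ?_
    rw [← realizeTrim_trimMap, h, map_zero]
    rfl

/-! ### The Hopf ideal and the quotient -/

theorem mem_kerRealize_iff (x : NatFree ar K) :
    x ∈ kerRealize ar K (lengths S) ↔ trimMap ar K x = 0 :=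
  realize_eq_zero_iff K x

instance isHopfIdeal_kerRealize : (kerRealize ar K (lengths S)).IsHopfIdeal K where
  counit_eq_zero x hx := by
    rw [← CoalgHomClass.counit_comp_apply (trimMap ar K) x, (mem_kerRealize_iff K x).1 hx, map_zero]
  map_mkQ_comul_eq_zero x hx := by
    set I := (kerRealize ar K (lengths S)).restrictScalars K
    -- Thanks to the section, the projection factors through trimming. Then the tensor square of the
    -- projection, applied to the coproduct of `x`, factors through the coproduct of `trimMap ar K x
    -- = 0`, and no description of the kernel of a tensor product of maps is needed.
    have e : I.mkQ = (I.mkQ ∘ₗ trimSection ar K) ∘ₗ (trimMap ar K).toCoalgHom.toLinearMap := by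
      refine LinearMap.ext fun x => (Submodule.Quotient.eq I).2 ?_
      refine (mem_kerRealize_iff K _).2 ?_
      rw [map_sub]
      exact sub_eq_zero.2 (trimMap_trimSection K _).symm
    rw [e, TensorProduct.map_comp, LinearMap.comp_apply]
    have := CoalgHomClass.map_comp_comul_apply (trimMap ar K) x
    rw [(mem_kerRealize_iff K x).1 hx, map_zero] at this
    erw [this]
    exact map_zero _
  antipode_mem x hx := by
    rw [mem_kerRealize_iff, bialgHom_antipode, (mem_kerRealize_iff K x).1 hx, map_zero]

variable (ar) in
/-- The morphism of bialgebras induced by trimming on the quotient by the kernel. -/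
noncomputable def quotientTrim :
    (NatFree ar K ⧸ kerRealize ar K (lengths S)) →ₐc[K] NCK ar K :=
  .ofAlgHom (Ideal.Quotient.liftₐ _ (trimMap ar K : NatFree ar K →ₐ[K] NCK ar K)
      fun x hx => (mem_kerRealize_iff K x).1 hx)
    (Ideal.Quotient.algHom_ext K (AlgHom.ext fun x =>
      CoalgHomClass.counit_comp_apply (trimMap ar K) x))
    (Ideal.Quotient.algHom_ext K (AlgHom.ext fun x => by
      refine Eq.trans ?_ (CoalgHomClass.map_comp_comul_apply (trimMap ar K) x)
      -- The coproduct of a class is the image of the coproduct under `q ⊗ q`, and `l ∘ q` is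
      -- trimming; the claim reduces to the compatibility of `trimMap` with coproducts.
      let q := (Ideal.Quotient.mkₐ K (kerRealize ar K (lengths S))).toLinearMap
      let l := (Ideal.Quotient.liftₐ (kerRealize ar K (lengths S))
        (trimMap ar K : NatFree ar K →ₐ[K] NCK ar K)
        fun x hx => (mem_kerRealize_iff K x).1 hx).toLinearMap
      change TensorProduct.map l l (TensorProduct.map q q (Coalgebra.comul x)) = _
      rw [← LinearMap.comp_apply, ← TensorProduct.map_comp]
      rfl))

/-- Injective because the ideal is exactly the kernel of trimming; onto because the class of
`trimSection ar K y` is a preimage of `y`. -/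
theorem quotientTrim_bijective : Function.Bijective (quotientTrim ar K) := by
  constructor
  · rw [injective_iff_map_eq_zero]
    intro x hx
    obtain ⟨x, rfl⟩ := Ideal.Quotient.mk_surjective x
    exact Ideal.Quotient.eq_zero_iff_mem.2 ((mem_kerRealize_iff K x).2 hx)
  · exact fun y => ⟨Ideal.Quotient.mk _ (trimSection ar K y), trimMap_trimSection K y⟩

end TrimMap
end NaturalHopf

/-! ### The theorem -/

open NaturalHopf
theorem mainTheorem5 (K : Type*) [Field K] [CharZero K] (S : Type*) (ar : S → ℕ) :
    LinearMap.ker (realize ar K (ForestLikeAlphabet.lengths S)) =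
        Submodule.span K {x | ∃ f₁ f₂ : List (NTerm ar), tr f₁ = tr f₂ ∧ x = E K f₁ - E K f₂} ∧
      ∃ _ : (kerRealize ar K (ForestLikeAlphabet.lengths S)).IsHopfIdeal K,
        ∃ φ : (NatFree ar K ⧸ kerRealize ar K (ForestLikeAlphabet.lengths S)) ≃ₐc[K] NCK ar K,
          (∀ f : List (NTerm ar), φ (Ideal.Quotient.mk _ (E K f)) = E K (tr f)) ∧
          (∀ x, φ (HopfAlgebra.antipode K x) = HopfAlgebra.antipode K (φ x)) ∧
          ∀ ψ : (NatFree ar K ⧸ kerRealize ar K (ForestLikeAlphabet.lengths S)) →ₗ[K] NCK ar K,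
            (∀ f : List (NTerm ar), ψ (Ideal.Quotient.mk _ (E K f)) = E K (tr f)) →
              ∀ x, ψ x = φ x := by
  refine ⟨?_, isHopfIdeal_kerRealize K,
    .ofBijective (quotientTrim ar K) (quotientTrim_bijective K), fun f => trimMap_E K f,
    fun x => bialgHom_antipode (quotientTrim ar K) x, fun ψ hψ x => ?_⟩
  · ext x
    rw [LinearMap.mem_ker, realize_eq_zero_iff, trimMap_eq_zero_iff]
  -- Uniqueness: the classes of the `E_f` span the quotient, so a linear map is determined by its
  -- values on them.
  · obtain ⟨x, rfl⟩ := Ideal.Quotient.mk_surjective x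
    refine word_induction (p := fun x => ψ (Ideal.Quotient.mk _ x) = trimMap ar K x)
      (fun f => ?_) (fun a b ha hb => ?_) (fun c a ha => ?_) x
    · rw [hψ, trimMap_E]
    · rw [map_add, map_add, map_add, ha, hb]
    · rw [map_smul (trimMap ar K), ← ha, ← map_smul]
      rfl
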